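/- Let $G$ be a finite graph, possibly with loops and multiple edges, with vertex set $V(G)$, edge set $E(G)$ and $n=|V(G)|$. Identify spanning subgraphs of $G$ with subsets $S\subseteq E(G)$, let $\mathcal S(G)=2^{E(G)}$, let $\kappa(S)$ be the number of connected components of $(V(G),S)$, and let $\kappa=\kappa(E(G))$. Fix a total order $<$ on $E(G)$, a reference orientation, which gives each edge $e$ a positive direction $e^+$ and the opposite direction $e^-$, and arbitrary sign labels $\sigma_u,\sigma_b\colon E(G)\to\{+,-\}$. *Activities of subgraphs.* A cut of $G$ is a minimal nonempty set $C$ of edges with $\kappa(E(G)\setminus C)>\kappa$; a cycle is a minimal nonempty set of edges of which no cut contains exactly one element. For $S\in\mathcal S(G)$ let $\hat I(S)$ be the set of edges $e$ that are the minimum of some cut disjoint from $S\setminus\{e\}$, and $\hat L(S)$ the set of edges $e$ that are the minimum of some cycle contained in $S\cup\{e\}$. *Fourientations.* A fourientation is an arbitrary subset $O$ of $\{e^+,e^-: e\in E(G)\}$; the set of all fourientations is $\mathcal O^4(G)$. Let $O^u$, $O^b$, $O^+$, $O^-$ be the sets of edges $e$ for which $O\cap\{e^+,e^-\}$ is $\varnothing$,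 $\{e^+,e^-\}$, $\{e^+\}$, $\{e^-\}$ respectively, and $O^o=O^+\cup O^-$. A directed cut (directed cycle) is a cut (cycle) with one of its two consistent orientations. A potential cut of $O$ is a directed cut such that $O$ contains the opposite of none of its directed edges; a potential cycle of $O$ is a directed cycle all of whose directed edges belong to $O$. Put - $I^o(O)=\{e\in O^o: e$ is the minimum edge of some potential cut of $O\}$, - $L^o(O)=\{e\in O^o: e$ is the minimum edge of some potential cycle of $O\}$, - $I^u(O)=\{e\in O^u: e$ is the minimum edge of some potential cut of $O\cup\{e^{\sigma_u(e)}\}\}$, - $L^b(O)=\{e\in O^b: e$ is the minimum edge of some potential cycle of $O\setminus\{e^{\sigma_b(e)}\}\}$. For a map $\varphi\colon\mathcal O^4(G)\to\mathcal S(G)$ put $I(O)=\hat I(\varphi(O))$ and $L(O)=\hat L(\varphi(O))$, and consider the following conditions, required for all $O\in\mathcal O^4(G)$: 1. $\varphi$ is a $2^{|E(G)|}$-to-one surjection, and $O\mapsto(\varphi(O),O^o)$ is a bijection $\mathcal O^4(G)\to\mathcal S(G)\times\mathcal S(G)$; 2. $O^u\cap\varphi(O)=\varnothing$ and $O^b\subseteq\varphi(O)$;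 3. $I(O)\cap O^o=I^o(O)$, $I(O)\cap O^u=I^u(O)$, $L(O)\cap O^o=L^o(O)$ and $L(O)\cap O^b=L^b(O)$; 4. $I(O)\cap O^+\subseteq\varphi(O)$, $I(O)\cap O^-\cap\varphi(O)=\varnothing$, $L(O)\cap O^-\subseteq\varphi(O)$ and $L(O)\cap O^+\cap\varphi(O)=\varnothing$; 5. if $O^o=\varnothing$, then $I(O)=\hat I(O^b)$ and $L(O)=\hat L(O^b)$. **Theorem.** A map $\varphi$ satisfying 1–5 exists. Moreover, for every such $\varphi$, every commutative ring $R$, all functions $k_1,k_2,l,m\colon E(G)\to R$ and all $w,z\in R$, $$N_G\bigl(k_1(e)+m(e),\,k_2(e)+l(e);\,1+w,\,1+z\bigr)=\sum_{O\in\mathcal O^4(G)}\ \prod_{e\in O^o\cap\varphi(O)}k_1(e)\prod_{e\in O^o\setminus\varphi(O)}k_2(e)\prod_{e\in O^u}l(e)\prod_{e\in O^b}m(e)\cdot w^{|I^u(O)\cup I^-(O)|}\,z^{|L^b(O)\cup L^-(O)|},$$ where $I^u(O)=I(O)\cap O^u$, $I^-(O)=I(O)\cap O^-$, $L^b(O)=L(O)\cap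 O^b$, $L^-(O)=L(O)\cap O^-$, and $N_G$ is the normal function $$N_G(\alpha(e),\beta(e);u,v)=\sum_{S\in\mathcal S(G)}\Bigl(\prod_{e\in S}\alpha(e)\Bigr)\Bigl(\prod_{e\notin S}\beta(e)\Bigr)(u-1)^{\kappa(S)-\kappa}(v-1)^{|S|-n+\kappa(S)}.$$ -/

import Mathlib

open scoped Graph

namespace Fourientation

noncomputable section

section Subgraphs

variable {α β : Type*} (G : Graph α β)

/-- A spanning subgraph `(V(G), S)` of `G`, identified with its set `S` of edges. -/
abbrev SpanningSubgraph := Finset E(G)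

variable {G}

/-- `κ(S)`: the number of connected components of the spanning subgraph `(V(G), S)`, that is, the
number of classes of the equivalence relation on `V(G)` generated by being joined by an edge
of `S`. -/
def numComponents (S : SpanningSubgraph G) : ℕ :=
  Nat.card (Quot fun x y : V(G) => ∃ e ∈ S, G.IsLink (e : β) (x : α) (y : α))

variable [Fintype E(G)] [LinearOrder E(G)]

/-- The edge sets of cuts: minimal among the nonempty `S` with `κ(E(G) \ S) > κ(G)`. -/
def IsCut (C : SpanningSubgraph G) : Prop :=
  Minimal (fun S : SpanningSubgraph G =>
    S.Nonempty ∧ numComponents (Finset.univ : SpanningSubgraph G) < numComponents Sᶜ) C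

/-- The edge sets of cycles: minimal among the nonempty `S` such that no cut includes precisely
one element of `S`. -/
def IsCycle (C : SpanningSubgraph G) : Prop :=
  Minimal (fun S : SpanningSubgraph G =>
    S.Nonempty ∧ ∀ D : SpanningSubgraph G, IsCut D → (D ∩ S).card ≠ 1) C

open Classical in
/-- The generalized cut activity `Î(S)`: the edges `e` that are the minimum edge of some cut
disjoint from `S \ {e}`. -/
def cutActive (S : SpanningSubgraph G) : SpanningSubgraph G :=
  Finset.univ.filter fun e =>
    ∃ C : SpanningSubgraph G, IsCut C ∧ Disjoint C (S.erase e) ∧ IsLeast (C : Set E(G)) e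

open Classical in
/-- The generalized cycle activity `L̂(S)`: the edges `e` that are the minimum edge of some cycle
contained in `S ∪ {e}`. -/
def cycleActive (S : SpanningSubgraph G) : SpanningSubgraph G :=
  Finset.univ.filter fun e =>
    ∃ C : SpanningSubgraph G, IsCycle C ∧ C ⊆ insert e S ∧ IsLeast (C : Set E(G)) e

/-- Zaslavsky's normal function `N_G(a, b; u, v)`. Both exponents are differences of natural
numbers that are never negative: `κ(S) ≥ κ(G)` and `|S| + κ(S) ≥ |V(G)|`. -/
def normalFunction {R : Type*} [CommRing R] (a b : E(G) → R) (u v : R) : R :=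
  ∑ S : SpanningSubgraph G, (∏ e ∈ S, a e) * (∏ e ∈ Sᶜ, b e) *
    (u - 1) ^ (numComponents S - numComponents (Finset.univ : SpanningSubgraph G)) *
    (v - 1) ^ (S.card + numComponents S - Nat.card V(G))

end Subgraphs

section Orientations

variable {α β : Type*} (G : Graph α β)

/-- A reference orientation: the positive direction `e⁺` of the edge `e` runs from `tail e`
to `head e`. -/
structure RefOrientation where
  tail : E(G) → V(G)
  head : E(G) → V(G)
  isLink : ∀ e : E(G), G.IsLink (e : β) (tail e : α) (head e : α)

/-- The set `{e⁺, e⁻ : e ∈ E(G)}` of signed edges: `(e, true)` is `e⁺` and `(e, false)` is `e⁻`. -/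
abbrev SignedEdge := E(G) × Bool

/-- A fourientation: an arbitrary set of signed edges. -/
abbrev Four := Finset (SignedEdge G)

variable {G}

/-- The other direction of the same edge. -/
def SignedEdge.rev (d : SignedEdge G) : SignedEdge G := (d.1, !d.2)

/-- The vertex at which a signed edge starts. -/
def RefOrientation.src (ref : RefOrientation G) (d : SignedEdge G) : V(G) :=
  if d.2 then ref.tail d.1 else ref.head d.1

/-- The vertex at which a signed edge ends. -/
def RefOrientation.dst (ref : RefOrientation G) (d : SignedEdge G) : V(G) :=
  if d.2 then ref.head d.1 else ref.tail d.1

variable [Fintype E(G)] [LinearOrder E(G)]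

/-- `O⁺`: the edges that are simply oriented in agreement with the reference orientation. -/
def posEdges (O : Four G) : SpanningSubgraph G :=
  Finset.univ.filter fun e => (e, true) ∈ O ∧ (e, false) ∉ O

/-- `O⁻`: the edges that are simply oriented in disagreement with the reference orientation. -/
def negEdges (O : Four G) : SpanningSubgraph G :=
  Finset.univ.filter fun e => (e, false) ∈ O ∧ (e, true) ∉ O

/-- `Oᵒ`: the simply oriented edges. -/
def orientedEdges (O : Four G) : SpanningSubgraph G := posEdges O ∪ negEdges O

/-- `Oᵘ`: the unoriented edges. -/
def unorientedEdges (O : Four G) : SpanningSubgraph G :=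
  Finset.univ.filter fun e => (e, true) ∉ O ∧ (e, false) ∉ O

/-- `Oᵇ`: the bioriented edges. -/
def biorientedEdges (O : Four G) : SpanningSubgraph G :=
  Finset.univ.filter fun e => (e, true) ∈ O ∧ (e, false) ∈ O

/-- The set of edges that occur in a set of signed edges. -/
def edges (D : Finset (SignedEdge G)) : SpanningSubgraph G := D.image Prod.fst

/-- A directed cut: a cut that consists of the edges between `X` and its complement, all of them
directed out of `X`. (Exchanging `X` and its complement gives the opposite orientation.) -/
def IsDirectedCut (ref : RefOrientation G) (D : Finset (SignedEdge G)) : Prop :=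
  IsCut (edges D) ∧
    ∃ X : Set V(G), ∀ d : SignedEdge G, d ∈ D ↔ ref.src d ∈ X ∧ ref.dst d ∉ X

/-- A directed cycle: a cycle whose edges, each used once and in one direction, can be arranged
in a cyclic sequence in which each of them ends where the next one starts. -/
def IsDirectedCycle (ref : RefOrientation G) (D : Finset (SignedEdge G)) : Prop :=
  IsCycle (edges D) ∧
    ∃ c : Cycle (SignedEdge G), (c.map Prod.fst).Nodup ∧ c.toFinset = D ∧
      c.Chain fun d d' => ref.dst d = ref.src d'

/-- A potential cut of `O`: a directed cut none of whose edges has its opposite direction in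
`O`. -/
def IsPotentialCut (ref : RefOrientation G) (O : Four G) (D : Finset (SignedEdge G)) : Prop :=
  IsDirectedCut ref D ∧ ∀ d ∈ D, d.rev ∉ O

/-- A potential cycle of `O`: a directed cycle all of whose directed edges belong to `O`. -/
def IsPotentialCycle (ref : RefOrientation G) (O : Four G) (D : Finset (SignedEdge G)) : Prop :=
  IsDirectedCycle ref D ∧ D ⊆ O

/-- `e` is the minimum edge of some potential cut of `O`. -/
def IsMinOfPotentialCut (ref : RefOrientation G) (O : Four G) (e : E(G)) : Prop :=
  ∃ D, IsPotentialCut ref O D ∧ IsLeast (edges D : Set E(G)) e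

/-- `e` is the minimum edge of some potential cycle of `O`. -/
def IsMinOfPotentialCycle (ref : RefOrientation G) (O : Four G) (e : E(G)) : Prop :=
  ∃ D, IsPotentialCycle ref O D ∧ IsLeast (edges D : Set E(G)) e

open Classical in
/-- The intrinsic set `Iᵒ(O)`. -/
def orientedCutActive (ref : RefOrientation G) (O : Four G) : SpanningSubgraph G :=
  (orientedEdges O).filter fun e => IsMinOfPotentialCut ref O e

open Classical in
/-- The intrinsic set `Lᵒ(O)`. -/
def orientedCycleActive (ref : RefOrientation G) (O : Four G) : SpanningSubgraph G :=
  (orientedEdges O).filter fun e => IsMinOfPotentialCycle ref O e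

open Classical in
/-- The intrinsic set `Iᵘ(O)`, with respect to the sign labels `σu`. -/
def unorientedCutActive (ref : RefOrientation G) (σu : E(G) → Bool) (O : Four G) :
    SpanningSubgraph G :=
  (unorientedEdges O).filter fun e => IsMinOfPotentialCut ref (insert (e, σu e) O) e

open Classical in
/-- The intrinsic set `Lᵇ(O)`, with respect to the sign labels `σb`. -/
def biorientedCycleActive (ref : RefOrientation G) (σb : E(G) → Bool) (O : Four G) :
    SpanningSubgraph G :=
  (biorientedEdges O).filter fun e => IsMinOfPotentialCycle ref (O.erase (e, σb e)) e

/-- The cut activity `I(O) = Î(φ(O))` of fourientations that a map `φ` induces. -/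
def fourCutActive (φ : Four G → SpanningSubgraph G) (O : Four G) : SpanningSubgraph G :=
  cutActive (φ O)

/-- The cycle activity `L(O) = L̂(φ(O))` of fourientations that a map `φ` induces. -/
def fourCycleActive (φ : Four G → SpanningSubgraph G) (O : Four G) : SpanningSubgraph G :=
  cycleActive (φ O)

/-- The properties that are required of the map `φ` from fourientations to spanning subgraphs,
for the given edge order, reference orientation and sign labels. -/
structure IsActivityMap (ref : RefOrientation G) (σu σb : E(G) → Bool)
    (φ : Four G → SpanningSubgraph G) : Prop where
  card_fiber : ∀ S, (Finset.univ.filter fun O => φ O = S).card = 2 ^ Fintype.card E(G)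
  bijective : Function.Bijective fun O : Four G => (φ O, orientedEdges O)
  unoriented_disjoint : ∀ O, Disjoint (unorientedEdges O) (φ O)
  bioriented_subset : ∀ O, biorientedEdges O ⊆ φ O
  cut_oriented : ∀ O, fourCutActive φ O ∩ orientedEdges O = orientedCutActive ref O
  cut_unoriented : ∀ O, fourCutActive φ O ∩ unorientedEdges O = unorientedCutActive ref σu O
  cycle_oriented : ∀ O, fourCycleActive φ O ∩ orientedEdges O = orientedCycleActive ref O
  cycle_bioriented : ∀ O,
    fourCycleActive φ O ∩ biorientedEdges O = biorientedCycleActive ref σb O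
  cut_pos_subset : ∀ O, fourCutActive φ O ∩ posEdges O ⊆ φ O
  cut_neg_disjoint : ∀ O, Disjoint (fourCutActive φ O ∩ negEdges O) (φ O)
  cycle_neg_subset : ∀ O, fourCycleActive φ O ∩ negEdges O ⊆ φ O
  cycle_pos_disjoint : ∀ O, Disjoint (fourCycleActive φ O ∩ posEdges O) (φ O)
  cut_of_not_oriented : ∀ O, orientedEdges O = ∅ →
    fourCutActive φ O = cutActive (biorientedEdges O)
  cycle_of_not_oriented : ∀ O, orientedEdges O = ∅ →
    fourCycleActive φ O = cycleActive (biorientedEdges O)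

/-- The sum over all fourientations of the weight of `O` with respect to `φ`. -/
def fourientationSum {R : Type*} [CommRing R] (φ : Four G → SpanningSubgraph G)
    (k₁ k₂ l m : E(G) → R) (w z : R) : R :=
  ∑ O : Four G,
    (∏ e ∈ orientedEdges O ∩ φ O, k₁ e) * (∏ e ∈ orientedEdges O \ φ O, k₂ e) *
      (∏ e ∈ unorientedEdges O, l e) * (∏ e ∈ biorientedEdges O, m e) *
      w ^ (fourCutActive φ O ∩ unorientedEdges O ∪ fourCutActive φ O ∩ negEdges O).card *
      z ^ (fourCycleActive φ O ∩ biorientedEdges O ∪ fourCycleActive φ O ∩ negEdges O).card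

end Orientations

end

end Fourientation

/-!
Go through the edges from the greatest to the least and make each simply oriented edge bioriented
(contract it) or unoriented (delete it). One of the two directions of an edge can be contracted, and
the opposite one deleted, without affecting the activity of smaller edges: for cuts alone and for
cycles alone this follows by eliminating the edge from two potential cuts (cycles) that share a
smaller minimum, and the two choices are compatible because a directed cut and a directed cycle with
a common directed edge also have a pair of opposite ones. That direction depends only on the smaller
edges of `O` and on the greater edges of the resulting subgraph `φ O`. Hence `O` is recovered from
`φ O` and the set of simply oriented edges by going upwards from the least edge.

The two exponents in the normal function of a spanning subgraph `S` count the cut-active edges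
outside `S` and the cycle-active edges in `S`. The identity therefore results from expanding the
products over `S` and its complement and reindexing by the bijection.
-/

namespace Fourientation

section SignedSets

variable {E : Type*}

/-- The opposite of a signed element. On the signed edges of a graph it is `SignedEdge.rev`. -/
def opp (d : E × Bool) : E × Bool := (d.1, !d.2)

@[simp] lemma opp_mk (e : E) (s : Bool) : opp (e, s) = (e, !s) := rfl

@[simp] lemma opp_snd (d : E × Bool) : (opp d).2 = !d.2 := rfl

@[simp] lemma opp_opp (d : E × Bool) : opp (opp d) = d := by simp [opp]

lemma eq_or_eq_opp {d g : E × Bool} (h : g.1 = d.1) : g = d ∨ g = opp d := by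
  obtain ⟨e, _ | _⟩ := d <;> obtain ⟨f, _ | _⟩ := g <;> simp_all

/-- The signed elements whose opposites are not in `P`. It exchanges the elements that occur in `P`
in both directions and those that occur in none. -/
def dual (P : Set (E × Bool)) : Set (E × Bool) := {d | opp d ∉ P}

variable {P Q : Set (E × Bool)} {e f : E} {d : E × Bool} {A B : Set Bool} {s : Bool}

@[simp] lemma mem_dual : d ∈ dual P ↔ opp d ∉ P := Iff.rfl

@[simp] lemma dual_dual (P : Set (E × Bool)) : dual (dual P) = P := by
  ext d
  simp

/-- `P` with the set of directions of the element `e` replaced by `A`. -/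
def setState (P : Set (E × Bool)) (e : E) (A : Set Bool) : Set (E × Bool) :=
  {d | d.1 = e ∧ d.2 ∈ A ∨ d.1 ≠ e ∧ d ∈ P}

@[simp] lemma mk_mem_setState_self : (e, s) ∈ setState P e A ↔ s ∈ A := by simp [setState]

lemma mem_setState_of_ne (h : d.1 ≠ e) : d ∈ setState P e A ↔ d ∈ P := by simp [setState, h]

lemma setState_mono (h : A ⊆ B) : setState P e A ⊆ setState P e B :=
  fun _ => Or.imp_left (And.imp_right (@h _))

lemma setState_congr (h : ∀ d : E × Bool, d.1 ≠ e → (d ∈ P ↔ d ∈ Q)) :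
    setState P e A = setState Q e A := by
  ext d
  exact or_congr_right (and_congr_right fun hd => h d hd)

lemma subset_setState_singleton_iff {D : Finset (E × Bool)} (hD : (e, !s) ∉ D) :
    (∀ g ∈ D, g ∈ setState P e {s}) ↔ ∀ g ∈ D, g.1 ≠ e → g ∈ P := by
  refine ⟨fun h g hg hge => (mem_setState_of_ne hge).1 (h g hg), fun h g hg => ?_⟩
  by_cases hge : g.1 = e
  · rcases eq_or_eq_opp (d := (e, s)) hge with rfl | rfl
    · simp
    · exact absurd hg hD
  · exact (mem_setState_of_ne hge).2 (h g hg hge)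

lemma setState_eq_self (h : ∀ s, s ∈ A ↔ (e, s) ∈ P) : setState P e A = P := by
  ext ⟨f, s⟩
  by_cases hf : f = e
  · subst hf
    simp [h]
  · rw [mem_setState_of_ne hf]

lemma dual_setState : dual (setState P e A) = setState (dual P) e {s | (!s) ∉ A} := by
  ext ⟨f, s⟩
  by_cases hf : f = e
  · subst hf
    simp
  · rw [mem_dual, mem_setState_of_ne hf, mem_setState_of_ne (by simpa), mem_dual]

@[simp] lemma dual_setState_singleton : dual (setState P e {s}) = setState (dual P) e {s} := by
  rw [dual_setState]
  congr 1
  ext t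
  cases s <;> cases t <;> simp

@[simp] lemma dual_setState_empty : dual (setState P e ∅) = setState (dual P) e Set.univ := by
  simp [dual_setState]

@[simp] lemma dual_setState_univ : dual (setState P e Set.univ) = setState (dual P) e ∅ := by
  simp [dual_setState]

open Classical in
/-- The direction of `f` in `P`; if `P` has both directions of `f` or none, the label `τ f`
decides. -/
noncomputable def dirOf (τ : E → Bool) (P : Set (E × Bool)) (f : E) : Bool :=
  if (f, true) ∈ P ↔ (f, false) ∈ P then τ f else decide ((f, true) ∈ P)

variable {τ : E → Bool}

lemma dirOf_congr (h : ∀ s, (f, s) ∈ P ↔ (f, s) ∈ Q) : dirOf τ P f = dirOf τ Q f := by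
  by_cases ht : (f, true) ∈ P <;> by_cases hf : (f, false) ∈ P <;> simp [dirOf, ← h, ht, hf]

@[simp] lemma dirOf_dual : dirOf τ (dual P) f = dirOf τ P f := by
  by_cases ht : (f, true) ∈ P <;> by_cases hf : (f, false) ∈ P <;> simp [dirOf, ht, hf]

lemma dirOf_setState (h : f ≠ e) : dirOf τ (setState P e A) f = dirOf τ P f :=
  dirOf_congr fun _ => mem_setState_of_ne h

lemma dirOf_eq (h : (f, s) ∈ P) (h' : (f, !s) ∉ P) : dirOf τ P f = s := by
  cases s <;> simp_all [dirOf]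

lemma dirOf_eq_label (h : (f, true) ∈ P ↔ (f, false) ∈ P) : dirOf τ P f = τ f := by
  simp [dirOf, h]

/-- `O` with the elements of `U` replaced by those of `S ∩ U` in both directions. -/
def splice (O : Set (E × Bool)) (S U : Set E) : Set (E × Bool) :=
  (Prod.fst ⁻¹' U).ite (Prod.fst ⁻¹' S) O

variable {O : Set (E × Bool)} {S U : Set E}

lemma mem_splice_of_mem (h : d.1 ∈ U) : d ∈ splice O S U ↔ d.1 ∈ S := by
  simp [splice, Set.ite, h]

lemma mem_splice_of_notMem (h : d.1 ∉ U) : d ∈ splice O S U ↔ d ∈ O := by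
  simp [splice, Set.ite, h]

lemma splice_insert (O : Set (E × Bool)) (S U : Set E) (e : E) :
    splice O S (insert e U) = setState (splice O S U) e {_s | e ∈ S} := by
  ext ⟨f, s⟩
  by_cases hf : f = e
  · subst hf
    simp [mem_splice_of_mem]
  · rw [mem_setState_of_ne hf]
    simp [splice, Set.ite, hf]

lemma dirOf_splice (h : f ∉ U) : dirOf τ (splice O S U) f = dirOf τ O f :=
  dirOf_congr fun _ => mem_splice_of_notMem h

variable [LinearOrder E] {𝓓 : Finset (E × Bool) → Prop}

/-- `d` lies over the minimum element of `D`, a member of the family `𝓓` that is included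
in `P`. -/
structure IsMinOf (𝓓 : Finset (E × Bool) → Prop) (P : Set (E × Bool)) (d : E × Bool)
    (D : Finset (E × Bool)) : Prop where
  family : 𝓓 D
  mem : d ∈ D
  le : ∀ g ∈ D, d.1 ≤ g.1
  subset : ∀ g ∈ D, g ∈ P

/-- `d` lies over the minimum element of some member of the family `𝓓` that is included in `P`. -/
def IsMinIn (𝓓 : Finset (E × Bool) → Prop) (P : Set (E × Bool)) (d : E × Bool) : Prop :=
  ∃ D, IsMinOf 𝓓 P d D

lemma IsMinIn.mem (h : IsMinIn 𝓓 P d) : d ∈ P :=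
  let ⟨_, hD⟩ := h
  hD.subset d hD.mem

lemma IsMinIn.mono (h : IsMinIn 𝓓 P d) (hPQ : P ⊆ Q) : IsMinIn 𝓓 Q d :=
  let ⟨D, hD⟩ := h
  ⟨D, hD.family, hD.mem, hD.le, fun g hg => hPQ (hD.subset g hg)⟩

lemma IsMinIn.congr (h : IsMinIn 𝓓 P d) (hPQ : ∀ g : E × Bool, d.1 ≤ g.1 → (g ∈ P ↔ g ∈ Q)) :
    IsMinIn 𝓓 Q d :=
  let ⟨D, hD⟩ := h
  ⟨D, hD.family, hD.mem, hD.le, fun g hg => (hPQ g (hD.le g hg)).1 (hD.subset g hg)⟩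

/-- The activity of elements that the fourientation `P` determines by itself: `f` is the minimum of
a member of `𝓓` that is included in `P` and uses `f` in its direction `dirOf τ P f`. -/
def IsActive (𝓓 : Finset (E × Bool) → Prop) (τ : E → Bool) (P : Set (E × Bool)) (f : E) : Prop :=
  IsMinIn 𝓓 P (f, dirOf τ P f)

lemma isActive_setState (h : f ≠ e) :
    IsActive 𝓓 τ (setState P e A) f ↔ IsMinIn 𝓓 (setState P e A) (f, dirOf τ P f) := by
  rw [IsActive, dirOf_setState h]

/-- The direction `s` of `e` is negligible for `𝓓`: adding it to `P`, without the other direction,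
does not affect the active elements below `e`. -/
def IsNegligible (𝓓 : Finset (E × Bool) → Prop) (τ : E → Bool) (P : Set (E × Bool)) (e : E)
    (s : Bool) : Prop :=
  ∀ f < e, IsActive 𝓓 τ (setState P e {s}) f ↔ IsActive 𝓓 τ (setState P e ∅) f

lemma exists_isMinOf_of_not_isNegligible (h : ¬ IsNegligible 𝓓 τ P e s) :
    ∃ f < e, ¬ IsMinIn 𝓓 (setState P e ∅) (f, dirOf τ P f) ∧
      ∃ D, IsMinOf 𝓓 (setState P e {s}) (f, dirOf τ P f) D ∧ (e, s) ∈ D := by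
  simp only [IsNegligible, not_forall] at h
  obtain ⟨f, hf, h⟩ := h
  rw [isActive_setState hf.ne, isActive_setState hf.ne] at h
  have h_empty : ¬ IsMinIn 𝓓 (setState P e ∅) (f, dirOf τ P f) := fun h_empty =>
    h ⟨fun _ => h_empty, fun h' => h'.mono (setState_mono (Set.empty_subset _))⟩
  obtain ⟨D, hD⟩ := not_not.1 fun h' => h (iff_of_false h' h_empty)
  refine ⟨f, hf, h_empty, D, hD, ?_⟩
  by_contra he
  refine h_empty ⟨D, hD.family, hD.mem, hD.le, fun g hg => ?_⟩
  obtain ⟨rfl, hs⟩ | hg' := hD.subset g hg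
  · exact absurd (show (g.1, s) ∈ D from (hs : g.2 = s) ▸ hg) he
  · exact Or.inr hg'

lemma isMinIn_setState_congr (h : ∀ g : E × Bool, e < g.1 → (g ∈ P ↔ g ∈ Q)) :
    IsMinIn 𝓓 (setState P e A) (e, s) ↔ IsMinIn 𝓓 (setState Q e A) (e, s) := by
  have congr_of_le (g : E × Bool) (hg : e ≤ g.1) : g ∈ setState P e A ↔ g ∈ setState Q e A :=
    or_congr_right (and_congr_right fun hge => h g (hg.lt_of_ne' hge))
  exact ⟨fun hd => hd.congr congr_of_le, fun hd => hd.congr fun g hg => (congr_of_le g hg).symm⟩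

lemma isMinIn_setState_singleton_iff (h𝓓 : ∀ {D d}, 𝓓 D → d ∈ D → opp d ∉ D)
    (he : (e, s) ∈ P) : IsMinIn 𝓓 (setState P e {s}) (e, s) ↔ IsMinIn 𝓓 P (e, s) := by
  refine exists_congr fun D => ⟨fun hD => ⟨hD.family, hD.mem, hD.le, fun g hg => ?_⟩,
    fun hD => ⟨hD.family, hD.mem, hD.le, ?_⟩⟩
  · have h_sub := (subset_setState_singleton_iff (h𝓓 hD.family hD.mem)).1 hD.subset
    by_cases hge : g.1 = e
    · rcases eq_or_eq_opp (d := (e, s)) hge with rfl | rfl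
      · exact he
      · exact absurd hg (h𝓓 hD.family hD.mem)
    · exact h_sub g hg hge
  · exact (subset_setState_singleton_iff (h𝓓 hD.family hD.mem)).2
      fun g hg _ => hD.subset g hg

lemma exists_isMinIn_iff (h : (e, !s) ∉ P) : (∃ t, IsMinIn 𝓓 P (e, t)) ↔ IsMinIn 𝓓 P (e, s) := by
  refine ⟨fun ⟨t, ht⟩ => ?_, fun hs => ⟨s, hs⟩⟩
  rcases eq_or_eq_opp (d := (e, s)) (g := (e, t)) rfl with h_eq | h_eq <;> rw [h_eq] at ht
  · exact ht
  · exact absurd ht.mem h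

/-- Whatever direction `e` is given in `P`, it is the minimum of a member of `𝓓` included
in `P`. -/
def IsMinBothWays (𝓓 : Finset (E × Bool) → Prop) (P : Set (E × Bool)) (e : E) : Prop :=
  ∀ s, IsMinIn 𝓓 (setState P e {s}) (e, s)

end SignedSets

section DualPairs

variable {E : Type*}

/-- Families of signed sets that behave like the directed cuts and the directed cycles of a graph,
or like the signed cocircuits and circuits of an oriented matroid: they are orthogonal, and one of
the two alternatives of Minty's painting lemma holds. -/
structure IsDualPair (𝓒 𝓛 : Finset (E × Bool) → Prop) : Prop where
  opp_notMem_left : ∀ {C d}, 𝓒 C → d ∈ C → opp d ∉ C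
  opp_notMem_right : ∀ {L d}, 𝓛 L → d ∈ L → opp d ∉ L
  orthogonal : ∀ {C L d}, 𝓒 C → 𝓛 L → d ∈ C → d ∈ L → ∃ g ∈ C, opp g ∈ L
  painting : ∀ (P : Set (E × Bool)) (d : E × Bool),
    (∃ L, 𝓛 L ∧ d ∈ L ∧ ∀ g ∈ L, g = d ∨ g ∈ P) ∨
      ∃ C, 𝓒 C ∧ d ∈ C ∧ ∀ g ∈ C, g = d ∨ g ∈ dual P

namespace IsDualPair

variable {𝓒 𝓛 : Finset (E × Bool) → Prop}

lemma symm (h : IsDualPair 𝓒 𝓛) : IsDualPair 𝓛 𝓒 where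
  opp_notMem_left := h.opp_notMem_right
  opp_notMem_right := h.opp_notMem_left
  orthogonal hL hC hdL hdC :=
    let ⟨g, hgC, hgL⟩ := h.orthogonal hC hL hdC hdL
    ⟨opp g, hgL, by rwa [opp_opp]⟩
  painting P d := by simpa only [dual_dual, or_comm] using h.painting (dual P) d

lemma notMem_of_subset_dual (h : IsDualPair 𝓒 𝓛) {C L : Finset (E × Bool)} {P : Set (E × Bool)}
    (hC : 𝓒 C) (hL : 𝓛 L) (hCP : ∀ g ∈ C, g ∈ dual P) (hLP : ∀ g ∈ L, g ∈ P) {d : E × Bool}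
    (hd : d ∈ C) : d ∉ L := fun hd' =>
  let ⟨g, hgC, hgL⟩ := h.orthogonal hC hL hd hd'
  hCP g hgC (hLP _ hgL)

/-- A circuit through `d` that the painting lemma would produce instead meets `D₁` or `D₂`
orthogonally only in `d` and `a`, where it has the wrong sign for one of them. -/
lemma elimination (h : IsDualPair 𝓒 𝓛) {D₁ D₂ : Finset (E × Bool)} (h₁ : 𝓒 D₁) (h₂ : 𝓒 D₂)
    {d a : E × Bool} (ha₁ : a ∈ D₁) (ha₂ : opp a ∈ D₂) (hd₁ : d ∈ D₁) (hd₂ : opp d ∉ D₂)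
    (hda : d.1 ≠ a.1) :
    ∃ D, 𝓒 D ∧ d ∈ D ∧ ∀ g ∈ D, g.1 ≠ a.1 ∧ (g ∈ D₁ ∨ g ∈ D₂) := by
  rcases h.symm.painting {g | g.1 ≠ a.1 ∧ (g ∈ D₁ ∨ g ∈ D₂)} d with
    ⟨D, hD, hdD, hDP⟩ | ⟨L, hL, hdL, hLP⟩
  · refine ⟨D, hD, hdD, fun g hg => ?_⟩
    rcases hDP g hg with rfl | hg
    · exact ⟨hda, Or.inl hd₁⟩
    · exact hg
  exfalso
  have fst_eq {g : E × Bool} (hgL : opp g ∈ L) (hg : g ∈ D₁ ∨ g ∈ D₂) : g.1 = a.1 := by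
    rcases hLP _ hgL with rfl | hgP
    · rw [opp_opp] at hd₂
      exact absurd hg (not_or_intro (fun hg => h.opp_notMem_left h₁ hg hd₁) hd₂)
    · by_contra hga
      exact hgP ⟨hga, by rwa [opp_opp]⟩
  have ha : opp a ∈ L := by
    obtain ⟨g, hg, hgL⟩ := h.orthogonal h₁ hL hd₁ hdL
    rcases eq_or_eq_opp (fst_eq hgL (Or.inl hg)) with rfl | rfl
    · exact hgL
    · exact absurd hg (h.opp_notMem_left h₁ ha₁)
  obtain ⟨g, hg, hgL⟩ := h.orthogonal h₂ hL ha₂ ha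
  rcases eq_or_eq_opp (fst_eq hgL (Or.inr hg)) with rfl | rfl
  · exact h.opp_notMem_left h₂ hg ha₂
  · exact h.opp_notMem_right hL ha hgL

variable [LinearOrder E] {P : Set (E × Bool)} {e : E} {d : E × Bool} {s : Bool}
  {τ τ' : E → Bool}

lemma isMinIn_setState_empty (h : IsDualPair 𝓒 𝓛) {D₁ D₂ : Finset (E × Bool)} {d₂ : E × Bool}
    (hD₁ : IsMinOf 𝓒 (setState P e {s}) d D₁) (he₁ : (e, s) ∈ D₁)
    (hD₂ : IsMinOf 𝓒 (setState P e {!s}) d₂ D₂) (he₂ : (e, !s) ∈ D₂)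
    (hd₂ : d = d₂ ∨ d.1 < d₂.1) (hde : d.1 ≠ e) : IsMinIn 𝓒 (setState P e ∅) d := by
  have hle : ∀ g ∈ D₂, d.1 ≤ g.1 := fun g hg =>
    (hd₂.elim (fun h => h ▸ le_rfl) le_of_lt).trans (hD₂.le g hg)
  have hopp : opp d ∉ D₂ := by
    rcases hd₂ with rfl | hlt
    · exact h.opp_notMem_left hD₂.family hD₂.mem
    · exact fun hmem => (hD₂.le _ hmem).not_gt hlt
  obtain ⟨D, hD, hdD, hDsub⟩ := h.elimination hD₁.family hD₂.family he₁ he₂ hD₁.mem hopp hde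
  refine ⟨D, hD, hdD, fun g hg => ?_, fun g hg => ?_⟩
  · exact (hDsub g hg).2.elim (hD₁.le g) (hle g)
  · obtain ⟨hge, hg⟩ := hDsub g hg
    rw [mem_setState_of_ne hge]
    exact hg.elim (fun hg => (mem_setState_of_ne hge).1 (hD₁.subset g hg))
      (fun hg => (mem_setState_of_ne hge).1 (hD₂.subset g hg))

lemma isNegligible_or_isNegligible (h : IsDualPair 𝓒 𝓛) (τ : E → Bool) (P : Set (E × Bool))
    (e : E) (s : Bool) : IsNegligible 𝓒 τ P e s ∨ IsNegligible 𝓒 τ P e !s := by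
  by_contra! hn
  obtain ⟨f₁, hf₁, hn₁, D₁, hD₁, he₁⟩ := exists_isMinOf_of_not_isNegligible hn.1
  obtain ⟨f₂, hf₂, hn₂, D₂, hD₂, he₂⟩ := exists_isMinOf_of_not_isNegligible hn.2
  rcases lt_trichotomy f₁ f₂ with hlt | rfl | hlt
  · exact hn₁ (h.isMinIn_setState_empty hD₁ he₁ hD₂ he₂ (Or.inr hlt) hf₁.ne)
  · exact hn₁ (h.isMinIn_setState_empty hD₁ he₁ hD₂ he₂ (Or.inl rfl) hf₁.ne)
  · rw [← Bool.not_not s] at hD₁ he₁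
    exact hn₂ (h.isMinIn_setState_empty hD₂ he₂ hD₁ he₁ (Or.inr hlt) hf₂.ne)

lemma isNegligible_of_not_isNegligible_dual (h : IsDualPair 𝓒 𝓛)
    (hs : ¬ IsNegligible 𝓒 τ (dual P) e s) : IsNegligible 𝓛 τ' P e s := by
  by_contra hs'
  obtain ⟨f₁, -, -, C, hC, heC⟩ := exists_isMinOf_of_not_isNegligible hs
  obtain ⟨f₂, -, -, L, hL, heL⟩ := exists_isMinOf_of_not_isNegligible hs'
  rw [← dual_setState_singleton] at hC
  exact h.notMem_of_subset_dual hC.family hL.family hC.subset hL.subset heC heL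

lemma isMinIn_setState_univ_iff (h : IsDualPair 𝓒 𝓛) :
    IsMinIn 𝓒 (setState P e Set.univ) d ↔
      IsMinIn 𝓒 (setState P e {s}) d ∨ IsMinIn 𝓒 (setState P e {!s}) d := by
  refine ⟨fun ⟨D, hD⟩ => ?_, fun hd => hd.elim ?_ ?_⟩
  · have of_notMem {t : Bool} (ht : (e, !t) ∉ D) : IsMinIn 𝓒 (setState P e {t}) d := by
      refine ⟨D, hD.family, hD.mem, hD.le, fun g hg => ?_⟩
      by_cases hge : g.1 = e
      · rcases eq_or_eq_opp (d := (e, t)) hge with rfl | rfl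
        · simp
        · exact absurd hg ht
      · exact (mem_setState_of_ne hge).2 ((mem_setState_of_ne hge).1 (hD.subset g hg))
    by_cases hs : (e, !s) ∈ D
    · exact Or.inr (of_notMem (h.opp_notMem_left hD.family hs))
    · exact Or.inl (of_notMem hs)
  all_goals exact fun hd => hd.mono (setState_mono (Set.subset_univ _))

lemma isActive_setState_univ_iff (h : IsDualPair 𝓒 𝓛) (hs : IsNegligible 𝓒 τ P e !s) {f : E}
    (hf : f < e) :
    IsActive 𝓒 τ (setState P e {s}) f ↔ IsActive 𝓒 τ (setState P e Set.univ) f := by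
  have hs := hs f hf
  simp only [isActive_setState hf.ne] at hs ⊢
  rw [h.isMinIn_setState_univ_iff (s := s), hs, or_iff_left_of_imp]
  exact fun h' => h'.mono (setState_mono (Set.empty_subset _))

lemma isNegligible_of_isMinBothWays (h : IsDualPair 𝓒 𝓛) (he : IsMinBothWays 𝓒 P e) :
    IsNegligible 𝓒 τ P e s := by
  by_contra hn
  obtain ⟨f, hf, hn, D, hD, heD⟩ := exists_isMinOf_of_not_isNegligible hn
  obtain ⟨D', hD'⟩ := he !s
  exact hn (h.isMinIn_setState_empty hD heD hD' hD'.mem (Or.inr hf) hf.ne)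

lemma isNegligible_of_isMinBothWays_dual (h : IsDualPair 𝓒 𝓛)
    (he : IsMinBothWays 𝓒 (dual P) e) : IsNegligible 𝓛 τ' P e s := by
  by_contra hn
  obtain ⟨f, -, -, L, hL, heL⟩ := exists_isMinOf_of_not_isNegligible hn
  obtain ⟨C, hC⟩ := he s
  rw [← dual_setState_singleton] at hC
  exact h.notMem_of_subset_dual hC.family hL.family hC.subset hL.subset hC.mem heL

lemma not_isMinBothWays_of_isMinBothWays_dual (h : IsDualPair 𝓒 𝓛)
    (he : IsMinBothWays 𝓒 (dual P) e) : ¬ IsMinBothWays 𝓛 P e := by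
  intro he'
  obtain ⟨C, hC⟩ := he true
  obtain ⟨L, hL⟩ := he' true
  rw [← dual_setState_singleton] at hC
  exact h.notMem_of_subset_dual hC.family hL.family hC.subset hL.subset hC.mem hL.mem

end IsDualPair

end DualPairs

section Contraction

variable {E : Type*} [LinearOrder E] (𝓒 𝓛 : Finset (E × Bool) → Prop) (τ τ' : E → Bool)

/-- The fourientations `P` and `Q` agree on whether `f` is active, for `𝓒` in their duals and
for `𝓛` in themselves. -/
def SameActivity (P Q : Set (E × Bool)) (f : E) : Prop :=
  (IsActive 𝓒 τ (dual P) f ↔ IsActive 𝓒 τ (dual Q) f) ∧ (IsActive 𝓛 τ' P f ↔ IsActive 𝓛 τ' Q f)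

/-- The direction `s` of `e` is contractible: if the state of the other elements is `P`, then
making `e` bioriented when it has direction `s`, and unoriented when it has the other direction,
does not affect the active elements below `e`. -/
def IsContractible (P : Set (E × Bool)) (e : E) (s : Bool) : Prop :=
  IsNegligible 𝓒 τ (dual P) e s ∧ IsNegligible 𝓛 τ' P e !s

open Classical in
/-- A contractible direction of `e`, chosen so that it is positive if `e` becomes active for `𝓒`,
and negative if `e` becomes active for `𝓛`. It depends only on the state of the elements
other than `e`. -/
noncomputable def contractDir (P : Set (E × Bool)) (e : E) : Bool :=
  decide (IsMinBothWays 𝓒 (dual P) e ∨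
    ¬ IsMinBothWays 𝓛 P e ∧ IsContractible 𝓒 𝓛 τ τ' P e true)

/-- `S` arises from the fourientation `O` by going through the elements from the greatest to the
least and making each of them bioriented if `O` has its direction `contractDir`, and unoriented
otherwise. Thus bioriented elements stay bioriented, unoriented elements stay unoriented, and
a simply oriented element joins `S` in one of its two directions. -/
def IsContraction (O : Set (E × Bool)) (S : Set E) : Prop :=
  ∀ e, e ∈ S ↔ (e, contractDir 𝓒 𝓛 τ τ' (splice O S (Set.Ioi e)) e) ∈ O

variable {𝓒 𝓛 τ τ'} {P Q O : Set (E × Bool)} {S : Set E} {e f : E} {s : Bool}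

lemma contractDir_congr (h : ∀ d : E × Bool, d.1 ≠ e → (d ∈ P ↔ d ∈ Q)) :
    contractDir 𝓒 𝓛 τ τ' P e = contractDir 𝓒 𝓛 τ τ' Q e := by
  have h_dual : ∀ d : E × Bool, d.1 ≠ e → (d ∈ dual P ↔ d ∈ dual Q) :=
    fun d hd => not_congr (h (opp d) hd)
  have h_left : IsMinBothWays 𝓒 (dual P) e ↔ IsMinBothWays 𝓒 (dual Q) e := by
    simp only [IsMinBothWays, setState_congr h_dual]
  have h_right : IsMinBothWays 𝓛 P e ↔ IsMinBothWays 𝓛 Q e := by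
    simp only [IsMinBothWays, setState_congr h]
  have h_true : IsContractible 𝓒 𝓛 τ τ' P e true ↔ IsContractible 𝓒 𝓛 τ τ' Q e true := by
    simp only [IsContractible, IsNegligible, setState_congr h, setState_congr h_dual]
  rw [contractDir, contractDir, decide_eq_decide, h_left, h_right, h_true]

lemma contractDir_eq_true (h : IsMinBothWays 𝓒 (dual P) e) : contractDir 𝓒 𝓛 τ τ' P e = true := by
  simp [contractDir, h]

lemma IsDualPair.contractDir_eq_false (h : IsDualPair 𝓒 𝓛) (he : IsMinBothWays 𝓛 P e) :
    contractDir 𝓒 𝓛 τ τ' P e = false := by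
  have he' : ¬ IsMinBothWays 𝓒 (dual P) e := fun he' =>
    h.not_isMinBothWays_of_isMinBothWays_dual he' he
  simp [contractDir, he, he']

lemma IsDualPair.isContractible_or_isContractible (h : IsDualPair 𝓒 𝓛) (P : Set (E × Bool))
    (e : E) : IsContractible 𝓒 𝓛 τ τ' P e true ∨ IsContractible 𝓒 𝓛 τ τ' P e false := by
  by_cases h₁ : IsNegligible 𝓒 τ (dual P) e true
  · by_cases h₂ : IsNegligible 𝓛 τ' P e false
    · exact Or.inl ⟨h₁, h₂⟩
    · refine Or.inr ⟨?_, (h.symm.isNegligible_or_isNegligible τ' P e false).resolve_left h₂⟩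
      exact not_not.1 fun h₃ => h₂ (h.isNegligible_of_not_isNegligible_dual h₃)
  · exact Or.inr ⟨(h.isNegligible_or_isNegligible τ (dual P) e true).resolve_left h₁,
      h.isNegligible_of_not_isNegligible_dual h₁⟩

lemma IsDualPair.isContractible_contractDir (h : IsDualPair 𝓒 𝓛) (P : Set (E × Bool)) (e : E) :
    IsContractible 𝓒 𝓛 τ τ' P e (contractDir 𝓒 𝓛 τ τ' P e) := by
  by_cases h_left : IsMinBothWays 𝓒 (dual P) e
  · exact ⟨h.isNegligible_of_isMinBothWays h_left, h.isNegligible_of_isMinBothWays_dual h_left⟩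
  by_cases h_right : IsMinBothWays 𝓛 P e
  · refine ⟨?_, h.symm.isNegligible_of_isMinBothWays h_right⟩
    exact h.symm.isNegligible_of_isMinBothWays_dual (by rwa [dual_dual])
  · by_cases h_true : IsContractible 𝓒 𝓛 τ τ' P e true
    · simp [contractDir, h_left, h_right, h_true]
    · simpa [contractDir, h_left, h_right, h_true] using
        (h.isContractible_or_isContractible P e).resolve_left h_true

lemma IsDualPair.sameActivity_setState_univ (h : IsDualPair 𝓒 𝓛)
    (hs : IsContractible 𝓒 𝓛 τ τ' P e s) (hf : f < e) :
    SameActivity 𝓒 𝓛 τ τ' (setState P e {s}) (setState P e Set.univ) f := by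
  rw [SameActivity, dual_setState_singleton, dual_setState_univ]
  exact ⟨hs.1 f hf, h.symm.isActive_setState_univ_iff hs.2 hf⟩

lemma IsDualPair.sameActivity_setState_empty (h : IsDualPair 𝓒 𝓛)
    (hs : IsContractible 𝓒 𝓛 τ τ' P e s) (hf : f < e) :
    SameActivity 𝓒 𝓛 τ τ' (setState P e {!s}) (setState P e ∅) f := by
  rw [SameActivity, dual_setState_singleton, dual_setState_empty]
  exact ⟨h.isActive_setState_univ_iff (by simpa using hs.1) hf, hs.2 f hf⟩

lemma IsDualPair.sameActivity_setState (h : IsDualPair 𝓒 𝓛)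
    (hs : IsContractible 𝓒 𝓛 τ τ' P e s) (hf : f < e) (A : Set Bool) :
    SameActivity 𝓒 𝓛 τ τ' (setState P e A) (setState P e {_t | s ∈ A}) f := by
  have hA : ∀ B : Set Bool, (s ∈ A ↔ s ∈ B) → ((!s) ∈ A ↔ (!s) ∈ B) → A = B := by
    intro B hB hB'
    ext t
    cases s <;> cases t <;> assumption
  by_cases h₁ : s ∈ A <;> by_cases h₂ : (!s) ∈ A
  · rw [hA Set.univ (by simpa) (by simpa)]
    simp [SameActivity]
  · rw [hA {s} (by simpa) (by simpa)]
    simpa using h.sameActivity_setState_univ hs hf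
  · rw [hA {!s} (by simpa) (by simpa)]
    simpa using h.sameActivity_setState_empty hs hf
  · rw [hA ∅ (by simpa) (by simpa)]
    simp [SameActivity]

variable (𝓒 𝓛 τ τ') in
lemma exists_isContraction [WellFoundedGT E] (O : Set (E × Bool)) :
    ∃ S, IsContraction 𝓒 𝓛 τ τ' O S := by
  let F (e : E) (ih : ∀ f, f > e → Prop) : Prop :=
    (e, contractDir 𝓒 𝓛 τ τ' (splice O {f | ∃ h : f > e, ih f h} (Set.Ioi e)) e) ∈ O
  have wf : WellFounded fun f e : E => f > e := wellFounded_gt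
  refine ⟨{e | wf.fix F e}, fun e => ?_⟩
  refine (iff_of_eq (wf.fix_eq F e)).trans (iff_of_eq ?_)
  dsimp only [F]
  congr 3
  ext d
  by_cases hd : d.1 ∈ Set.Ioi e
  · rw [mem_splice_of_mem hd, mem_splice_of_mem hd]
    exact exists_prop_of_true hd
  · rw [mem_splice_of_notMem hd, mem_splice_of_notMem hd]

namespace IsContraction

lemma sameActivity_splice_insert (hS : IsContraction 𝓒 𝓛 τ τ' O S) (h : IsDualPair 𝓒 𝓛)
    (hf : f < e) :
    SameActivity 𝓒 𝓛 τ τ' (splice O S (Set.Ioi e)) (splice O S (insert e (Set.Ioi e))) f := by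
  have step := h.sameActivity_setState
    (h.isContractible_contractDir (τ := τ) (τ' := τ') (splice O S (Set.Ioi e)) e) hf
    {s | (e, s) ∈ O}
  rw [setState_eq_self (A := {s | (e, s) ∈ O})
    fun s => (mem_splice_of_notMem Set.self_notMem_Ioi).symm] at step
  rw [splice_insert, hS e]
  exact step

lemma sameActivity_splice (hS : IsContraction 𝓒 𝓛 τ τ' O S) (h : IsDualPair 𝓒 𝓛) (U : Finset E)
    (hU : IsUpperSet (U : Set E)) (hf : ∀ e ∈ U, f < e) :
    SameActivity 𝓒 𝓛 τ τ' (splice O S U) O f := by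
  induction U using Finset.induction_on_min with
  | empty => simp [SameActivity, splice]
  | insert e U heU ih =>
    have hU_eq : (U : Set E) = Set.Ioi e := by
      ext g
      refine ⟨heU g, fun (heg : e < g) => ?_⟩
      simpa [heg.ne'] using hU heg.le (Finset.mem_coe.2 (Finset.mem_insert_self e U))
    have ih := ih (hU_eq ▸ isUpperSet_Ioi e) fun g hg => hf g (Finset.mem_insert_of_mem hg)
    have step := hS.sameActivity_splice_insert h (hf e (Finset.mem_insert_self e U))
    rw [Finset.coe_insert, hU_eq]
    rw [hU_eq] at ih
    exact ⟨step.1.symm.trans ih.1, step.2.symm.trans ih.2⟩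

lemma sameActivity_splice_Ioi [Finite E] (hS : IsContraction 𝓒 𝓛 τ τ' O S)
    (h : IsDualPair 𝓒 𝓛) (e : E) :
    SameActivity 𝓒 𝓛 τ τ' (splice O S (Set.Ioi e)) O e := by
  have hU := (Set.toFinite (Set.Ioi e)).coe_toFinset
  have := hS.sameActivity_splice (f := e) h (Set.toFinite (Set.Ioi e)).toFinset
  rw [hU] at this
  exact this (isUpperSet_Ioi e) fun f hf => by simpa using hf

lemma isMinIn_left_iff [Finite E] (hS : IsContraction 𝓒 𝓛 τ τ' O S) (h : IsDualPair 𝓒 𝓛)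
    (he : (e, dirOf τ O e) ∈ dual O) :
    IsMinIn 𝓒 (setState (dual (Prod.fst ⁻¹' S)) e {dirOf τ O e}) (e, dirOf τ O e) ↔
      IsMinIn 𝓒 (dual O) (e, dirOf τ O e) := by
  have he_splice : (e, dirOf τ O e) ∈ dual (splice O S (Set.Ioi e)) := by
    rwa [mem_dual, mem_splice_of_notMem (by simp), ← mem_dual]
  have h_active := (hS.sameActivity_splice_Ioi h e).1
  rw [IsActive, IsActive, dirOf_dual, dirOf_dual, dirOf_splice Set.self_notMem_Ioi] at h_active
  rw [← h_active, ← isMinIn_setState_singleton_iff h.opp_notMem_left he_splice]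
  exact isMinIn_setState_congr fun g hg => not_congr (mem_splice_of_mem (d := opp g) hg).symm

lemma isMinIn_right_iff [Finite E] (hS : IsContraction 𝓒 𝓛 τ τ' O S) (h : IsDualPair 𝓒 𝓛)
    (he : (e, dirOf τ' O e) ∈ O) :
    IsMinIn 𝓛 (setState (Prod.fst ⁻¹' S) e {dirOf τ' O e}) (e, dirOf τ' O e) ↔
      IsMinIn 𝓛 O (e, dirOf τ' O e) := by
  have he_splice : (e, dirOf τ' O e) ∈ splice O S (Set.Ioi e) := by
    rwa [mem_splice_of_notMem (by simp)]
  have h_active := (hS.sameActivity_splice_Ioi h e).2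
  rw [IsActive, IsActive, dirOf_splice Set.self_notMem_Ioi] at h_active
  rw [← h_active, ← isMinIn_setState_singleton_iff h.opp_notMem_right he_splice]
  exact isMinIn_setState_congr fun g hg => (mem_splice_of_mem hg).symm

lemma mem_iff_of_left (hS : IsContraction 𝓒 𝓛 τ τ' O S)
    (he : IsMinBothWays 𝓒 (dual (Prod.fst ⁻¹' S)) e) : e ∈ S ↔ (e, true) ∈ O := by
  rw [hS e, contractDir_eq_true]
  exact fun s => (isMinIn_setState_congr fun g hg =>
    not_congr (mem_splice_of_mem (d := opp g) hg)).2 (he s)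

lemma mem_iff_of_right (hS : IsContraction 𝓒 𝓛 τ τ' O S) (h : IsDualPair 𝓒 𝓛)
    (he : IsMinBothWays 𝓛 (Prod.fst ⁻¹' S) e) : e ∈ S ↔ (e, false) ∈ O := by
  rw [hS e, h.contractDir_eq_false]
  exact fun s => (isMinIn_setState_congr fun g hg => mem_splice_of_mem hg).2 (he s)

/-- The state of `e` in `O` can be read off from `S` and from whether `e` is simply oriented, once
the states of the elements below `e` are known, because these determine `contractDir`. -/
lemma eq_of_simple_iff [WellFoundedLT E] {O' : Set (E × Bool)} (hS : IsContraction 𝓒 𝓛 τ τ' O S)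
    (hS' : IsContraction 𝓒 𝓛 τ τ' O' S)
    (h : ∀ e, ((e, true) ∈ O ↔ (e, false) ∈ O) ↔ ((e, true) ∈ O' ↔ (e, false) ∈ O')) :
    O = O' := by
  suffices ∀ e s, (e, s) ∈ O ↔ (e, s) ∈ O' from Set.ext fun d => this d.1 d.2
  intro e
  induction e using WellFoundedLT.induction with
  | ind e ih =>
    have h_splice : contractDir 𝓒 𝓛 τ τ' (splice O S (Set.Ioi e)) e =
        contractDir 𝓒 𝓛 τ τ' (splice O' S (Set.Ioi e)) e := by
      refine contractDir_congr fun d hd => ?_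
      by_cases hde : d.1 ∈ Set.Ioi e
      · rw [mem_splice_of_mem hde, mem_splice_of_mem hde]
      · rw [mem_splice_of_notMem hde, mem_splice_of_notMem hde]
        exact ih d.1 (hd.lt_of_le (not_lt.1 hde)) d.2
    have h_mem := (hS e).symm.trans (hS' e)
    rw [← h_splice] at h_mem
    have h_simple := h e
    generalize contractDir 𝓒 𝓛 τ τ' (splice O S (Set.Ioi e)) e = t at h_mem
    intro s
    cases s <;> cases t <;> tauto

end IsContraction

end Contraction

section Components

variable {α β : Type*} {G : Graph α β}

/-- The connected components of the spanning subgraph `(V(G), S)`. -/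
abbrev Component (S : SpanningSubgraph G) :=
  Quot fun x y : V(G) => ∃ e ∈ S, G.IsLink (e : β) (x : α) (y : α)

/-- The vertices `x` and `y` lie in the same component of the spanning subgraph `(V(G), S)`. -/
def Joined (S : SpanningSubgraph G) (x y : V(G)) : Prop :=
  (Quot.mk _ x : Component S) = Quot.mk _ y

variable {S T : SpanningSubgraph G} {x y z : V(G)} {X : Set V(G)} {d : SignedEdge G}

@[refl] lemma Joined.refl (S : SpanningSubgraph G) (x : V(G)) : Joined S x x := rfl

lemma Joined.symm (h : Joined S x y) : Joined S y x := Eq.symm h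

lemma Joined.trans (h : Joined S x y) (h' : Joined S y z) : Joined S x z := Eq.trans h h'

lemma Joined.of_isLink {e : E(G)} (he : e ∈ S) (h : G.IsLink (e : β) (x : α) (y : α)) :
    Joined S x y :=
  Quot.sound ⟨e, he, h⟩

/-- The map on components that is induced by the inclusion of a spanning subgraph in another. -/
def Component.map (h : S ⊆ T) : Component S → Component T :=
  Quot.map id fun _ _ ⟨e, he, hl⟩ => ⟨e, h he, hl⟩

lemma Component.map_surjective (h : S ⊆ T) : Function.Surjective (Component.map h) := by
  rintro ⟨x⟩
  exact ⟨Quot.mk _ x, rfl⟩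

lemma Joined.mono (h : Joined S x y) (hST : S ⊆ T) : Joined T x y :=
  congrArg (Component.map hST) h

lemma numComponents_lt_iff [Finite V(G)] (h : S ⊆ T) :
    numComponents T < numComponents S ↔ ∃ x y, Joined T x y ∧ ¬ Joined S x y := by
  refine ⟨fun hlt => ?_, fun ⟨x, y, hT, hS⟩ => ?_⟩
  · by_contra! h_joined
    have h_inj : Function.Injective (Component.map h) := by
      rintro ⟨x⟩ ⟨y⟩ hxy
      exact h_joined x y hxy
    exact hlt.not_ge (Nat.card_le_card_of_injective _ h_inj)
  · by_contra hle
    exact hS (((Component.map_surjective h).bijective_of_nat_card_le (not_lt.1 hle)).injective hT)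

variable (ref : RefOrientation G)

@[simp] lemma RefOrientation.src_opp (d : SignedEdge G) : ref.src (opp d) = ref.dst d := by
  obtain ⟨e, _ | _⟩ := d <;> rfl

@[simp] lemma RefOrientation.dst_opp (d : SignedEdge G) : ref.dst (opp d) = ref.src d := by
  obtain ⟨e, _ | _⟩ := d <;> rfl

lemma RefOrientation.isLink_src_dst (d : SignedEdge G) :
    G.IsLink (d.1 : β) (ref.src d : α) (ref.dst d : α) := by
  obtain ⟨e, _ | _⟩ := d
  · exact (ref.isLink e).symm
  · exact ref.isLink e

lemma RefOrientation.exists_of_isLink {e : E(G)} (h : G.IsLink (e : β) (x : α) (y : α)) :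
    ∃ s, ref.src (e, s) = x ∧ ref.dst (e, s) = y := by
  rcases h.eq_and_eq_or_eq_and_eq (ref.isLink e) with ⟨hx, hy⟩ | ⟨hx, hy⟩
  · exact ⟨true, Subtype.ext hx.symm, Subtype.ext hy.symm⟩
  · exact ⟨false, Subtype.ext hx.symm, Subtype.ext hy.symm⟩

lemma RefOrientation.joined (hd : d.1 ∈ S) : Joined S (ref.src d) (ref.dst d) :=
  .of_isLink hd (ref.isLink_src_dst d)

variable {ref} in
lemma Joined.mem_iff_of_closed (h : Joined S x y)
    (hX : ∀ d : SignedEdge G, d.1 ∈ S → ref.src d ∈ X → ref.dst d ∈ X) : x ∈ X ↔ y ∈ X := by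
  have mem_of_isLink {x y : V(G)} {e : E(G)} (he : e ∈ S)
      (h : G.IsLink (e : β) (x : α) (y : α)) (hx : x ∈ X) : y ∈ X := by
    obtain ⟨s, rfl, rfl⟩ := ref.exists_of_isLink h
    exact hX (e, s) he hx
  let f : Component S → Prop := Quot.lift (· ∈ X) fun x y ⟨e, he, hl⟩ =>
    propext ⟨mem_of_isLink he hl, mem_of_isLink he hl.symm⟩
  exact iff_of_eq (congrArg f h)

variable [Fintype E(G)]

open Classical in
/-- The signed edges that lead out of the vertex set `X`. -/
noncomputable def outEdges (X : Set V(G)) : Finset (SignedEdge G) :=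
  Finset.univ.filter fun d => ref.src d ∈ X ∧ ref.dst d ∉ X

variable {ref}

@[simp] lemma mem_outEdges : d ∈ outEdges ref X ↔ ref.src d ∈ X ∧ ref.dst d ∉ X := by
  simp [outEdges]

lemma opp_mem_outEdges : opp d ∈ outEdges ref X ↔ d ∈ outEdges ref Xᶜ := by
  simp [and_comm]

lemma Joined.mem_iff (h : Joined S x y) (hX : ∀ d ∈ outEdges ref X, d.1 ∉ S) :
    x ∈ X ↔ y ∈ X :=
  h.mem_iff_of_closed fun d hd h_src =>
    not_not.1 fun h_dst => hX d (mem_outEdges.2 ⟨h_src, h_dst⟩) hd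

lemma notMem_of_mem_outEdges_setOf_joined (hd : d ∈ outEdges ref {y | Joined S x y}) :
    d.1 ∉ S := fun hS =>
  (mem_outEdges.1 hd).2 ((mem_outEdges.1 hd).1.trans (ref.joined hS))

lemma not_joined_iff (ref : RefOrientation G) :
    ¬ Joined S x y ↔ ∃ X : Set V(G), x ∈ X ∧ y ∉ X ∧ ∀ d ∈ outEdges ref X, d.1 ∉ S := by
  refine ⟨fun h => ⟨{y | Joined S x y}, Joined.refl S x, h, fun d hd => ?_⟩, ?_⟩
  · exact notMem_of_mem_outEdges_setOf_joined hd
  · rintro ⟨X, hx, hy, hX⟩ h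
    exact hy ((h.mem_iff hX).1 hx)

end Components

section DirectedCuts

variable {α β : Type*} {G : Graph α β} [LinearOrder E(G)]

lemma mem_edges {D : Finset (SignedEdge G)} {e : E(G)} : e ∈ edges D ↔ ∃ d ∈ D, d.1 = e :=
  Finset.mem_image

variable [Fintype E(G)] {ref : RefOrientation G} {S : SpanningSubgraph G} {X : Set V(G)}
  {d : SignedEdge G}

lemma mem_edges_outEdges :
    d.1 ∈ edges (outEdges ref X) ↔ d ∈ outEdges ref X ∨ d ∈ outEdges ref Xᶜ := by
  rw [mem_edges, ← opp_mem_outEdges]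
  refine ⟨fun ⟨g, hg, h⟩ => ?_, fun h => h.elim (fun h => ⟨d, h, rfl⟩) fun h => ⟨_, h, rfl⟩⟩
  rcases eq_or_eq_opp h with rfl | rfl
  · exact Or.inl hg
  · exact Or.inr hg

lemma mem_edges_outEdges_iff_not_iff :
    d.1 ∈ edges (outEdges ref X) ↔ ¬ (ref.src d ∈ X ↔ ref.dst d ∈ X) := by
  rw [mem_edges_outEdges, mem_outEdges, mem_outEdges, Set.mem_compl_iff, Set.mem_compl_iff]
  tauto

lemma edges_outEdges_compl (X : Set V(G)) :
    edges (outEdges ref Xᶜ) = edges (outEdges ref X) := by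
  ext e
  rw [show e = ((e, true) : SignedEdge G).1 from rfl, mem_edges_outEdges, mem_edges_outEdges,
    compl_compl, or_comm]

lemma numComponents_univ_lt_iff [Finite V(G)] (ref : RefOrientation G) :
    numComponents (Finset.univ : SpanningSubgraph G) < numComponents Sᶜ ↔
      ∃ X : Set V(G), (edges (outEdges ref X)).Nonempty ∧ edges (outEdges ref X) ⊆ S := by
  rw [numComponents_lt_iff (Finset.subset_univ _)]
  constructor
  · rintro ⟨x, y, h, h_not⟩
    obtain ⟨X, hx, hy, hX⟩ := (not_joined_iff ref).1 h_not
    refine ⟨X, ?_, fun e he => ?_⟩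
    · by_contra h_empty
      refine hy ((h.mem_iff (ref := ref) fun d hd => ?_).1 hx)
      exact absurd ⟨d.1, mem_edges.2 ⟨d, hd, rfl⟩⟩ h_empty
    · obtain ⟨d, hd, rfl⟩ := mem_edges.1 he
      exact not_not.1 (mt Finset.mem_compl.2 (hX d hd))
  · rintro ⟨X, ⟨e, he⟩, hX⟩
    obtain ⟨d, hd, rfl⟩ := mem_edges.1 he
    refine ⟨ref.src d, ref.dst d, ref.joined (Finset.mem_univ _), (not_joined_iff ref).2
      ⟨X, (mem_outEdges.1 hd).1, (mem_outEdges.1 hd).2, fun g hg => ?_⟩⟩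
    exact fun hg' => Finset.mem_compl.1 hg' (hX (mem_edges.2 ⟨g, hg, rfl⟩))

lemma isCut_iff [Finite V(G)] (ref : RefOrientation G) {C : SpanningSubgraph G} :
    IsCut C ↔ Minimal (fun S : SpanningSubgraph G =>
      S.Nonempty ∧ ∃ X : Set V(G), edges (outEdges ref X) = S) C := by
  have h_iff (S : SpanningSubgraph G) : (S.Nonempty ∧
      numComponents (Finset.univ : SpanningSubgraph G) < numComponents Sᶜ) ↔
      ∃ T ⊆ S, T.Nonempty ∧ ∃ X : Set V(G), edges (outEdges ref X) = T := by
    rw [numComponents_univ_lt_iff ref]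
    constructor
    · rintro ⟨-, X, hX, hS⟩
      exact ⟨_, hS, hX, X, rfl⟩
    · rintro ⟨T, hTS, hT, X, rfl⟩
      exact ⟨hT.mono hTS, X, hT, hTS⟩
  simp only [IsCut, h_iff]
  constructor
  · rintro ⟨⟨T, hTC, hT⟩, h_min⟩
    obtain rfl : T = C := hTC.antisymm (h_min ⟨T, subset_rfl, hT⟩ hTC)
    exact ⟨hT, fun U hU hUT => h_min ⟨U, subset_rfl, hU⟩ hUT⟩
  · rintro ⟨hC, h_min⟩
    exact ⟨⟨C, subset_rfl, hC⟩, fun U ⟨T, hTU, hT⟩ hUC =>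
      (h_min hT (hTU.trans hUC)).trans hTU⟩

lemma isDirectedCut_outEdges (h : IsCut (edges (outEdges ref X))) :
    IsDirectedCut ref (outEdges ref X) :=
  ⟨h, X, fun _ => mem_outEdges⟩

lemma IsDirectedCut.exists_eq {D : Finset (SignedEdge G)} (h : IsDirectedCut ref D) :
    ∃ X : Set V(G), D = outEdges ref X := by
  obtain ⟨-, X, hX⟩ := h
  exact ⟨X, Finset.ext fun d => by rw [hX, mem_outEdges]⟩

lemma IsCut.exists_isDirectedCut [Finite V(G)] {C : SpanningSubgraph G} (h : IsCut C)
    (hd : d.1 ∈ C) : ∃ D, IsDirectedCut ref D ∧ d ∈ D ∧ edges D = C := by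
  obtain ⟨X, rfl⟩ := ((isCut_iff ref).1 h).1.2
  rcases mem_edges_outEdges.1 hd with hd | hd
  · exact ⟨_, isDirectedCut_outEdges h, hd, rfl⟩
  · rw [← edges_outEdges_compl] at h ⊢
    exact ⟨_, isDirectedCut_outEdges h, hd, rfl⟩

lemma notMem_compl_edges {D : Finset (SignedEdge G)} (hd : d ∈ D) : d.1 ∉ (edges D)ᶜ :=
  fun h => Finset.mem_compl.1 h (mem_edges.2 ⟨d, hd, rfl⟩)

lemma compl_edges_subset {D D' : Finset (SignedEdge G)} (h : D ⊆ D') :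
    (edges D')ᶜ ⊆ (edges D)ᶜ :=
  Finset.compl_subset_compl.2 (Finset.image_subset_image h)

lemma isCut_edges_outEdges [Finite V(G)] (hd : d ∈ outEdges ref X)
    (h_src : ∀ g ∈ outEdges ref X, Joined (edges (outEdges ref X))ᶜ (ref.src d) (ref.src g))
    (h_dst : ∀ g ∈ outEdges ref X, Joined (edges (outEdges ref X))ᶜ (ref.dst d) (ref.dst g)) :
    IsCut (edges (outEdges ref X)) := by
  rw [isCut_iff ref]
  refine ⟨⟨⟨_, mem_edges.2 ⟨d, hd, rfl⟩⟩, X, rfl⟩, ?_⟩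
  rintro _ ⟨⟨e, he⟩, Z, rfl⟩ hZX
  have h_sides : ∀ g ∈ outEdges ref X, g.1 ∈ edges (outEdges ref Z) ↔
      ¬ (ref.src d ∈ Z ↔ ref.dst d ∈ Z) := by
    have hZ (g) (hg : g ∈ outEdges ref Z) : g.1 ∉ (edges (outEdges ref X))ᶜ := fun hg' =>
      Finset.mem_compl.1 hg' (hZX (mem_edges.2 ⟨g, hg, rfl⟩))
    intro g hg
    rw [mem_edges_outEdges_iff_not_iff, (h_src g hg).mem_iff hZ, (h_dst g hg).mem_iff hZ]
  obtain ⟨g₀, hg₀, rfl⟩ := mem_edges.1 (hZX he)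
  intro f hf
  obtain ⟨g, hg, rfl⟩ := mem_edges.1 hf
  exact (h_sides g hg).2 ((h_sides g₀ hg₀).1 he)

lemma exists_outEdges_subset_joined_src (hd : d ∈ outEdges ref X) :
    ∃ Y, d ∈ outEdges ref Y ∧ outEdges ref Y ⊆ outEdges ref X ∧
      ∀ g ∈ outEdges ref Y, Joined (edges (outEdges ref X))ᶜ (ref.src d) (ref.src g) := by
  let Y : Set V(G) := {x | Joined (edges (outEdges ref X))ᶜ (ref.src d) x}
  have hYX : Y ⊆ X := fun x (hx : Joined _ _ _) =>
    (hx.mem_iff fun _ => notMem_compl_edges).1 (mem_outEdges.1 hd).1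
  refine ⟨Y, ?_, fun g hg => ?_, fun g hg => (mem_outEdges.1 hg).1⟩
  · exact mem_outEdges.2 ⟨Joined.refl _ _, fun h => (mem_outEdges.1 hd).2 (hYX h)⟩
  · have h_edge := not_not.1 (mt Finset.mem_compl.2 (notMem_of_mem_outEdges_setOf_joined hg))
    refine (mem_edges_outEdges.1 h_edge).resolve_right fun h => ?_
    exact (mem_outEdges.1 h).1 (hYX (mem_outEdges.1 hg).1)

lemma exists_outEdges_subset_joined_dst (hd : d ∈ outEdges ref X) :
    ∃ Y, d ∈ outEdges ref Y ∧ outEdges ref Y ⊆ outEdges ref X ∧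
      ∀ g ∈ outEdges ref Y, Joined (edges (outEdges ref X))ᶜ (ref.dst d) (ref.dst g) := by
  obtain ⟨Y, hdY, hYX, hY⟩ := exists_outEdges_subset_joined_src (X := Xᶜ) (d := opp d)
    (opp_mem_outEdges.2 (by rwa [compl_compl]))
  rw [edges_outEdges_compl] at hY
  refine ⟨Yᶜ, opp_mem_outEdges.1 hdY, fun g hg => ?_, fun g hg => ?_⟩
  · simpa using opp_mem_outEdges.1 (hYX (opp_mem_outEdges.2 hg))
  · simpa using hY _ (opp_mem_outEdges.2 hg)

/-- Shrinking first the side of `ref.src d` and then the side of `ref.dst d` to a component leaves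
both sides connected. -/
lemma exists_isDirectedCut_subset [Finite V(G)] (hd : d ∈ outEdges ref X) :
    ∃ D, IsDirectedCut ref D ∧ d ∈ D ∧ D ⊆ outEdges ref X := by
  obtain ⟨Y, hdY, hYX, hY⟩ := exists_outEdges_subset_joined_src hd
  obtain ⟨Z, hdZ, hZY, hZ⟩ := exists_outEdges_subset_joined_dst hdY
  refine ⟨_, isDirectedCut_outEdges (isCut_edges_outEdges hdZ (fun g hg => ?_) fun g hg => ?_),
    hdZ, hZY.trans hYX⟩
  · exact (hY g (hZY hg)).mono (compl_edges_subset (hZY.trans hYX))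
  · exact (hZ g hg).mono (compl_edges_subset hZY)

end DirectedCuts

section CyclicSequences

variable {γ δ : Type*} {c : Cycle γ}

lemma mem_cycle_toFinset [DecidableEq γ] {a : γ} : a ∈ c.toFinset ↔ a ∈ c := by
  rw [← Cycle.toFinset_toMultiset, Multiset.mem_toFinset]
  induction c using Quotient.inductionOn with | _ l
  simp

lemma eq_of_nodup_cycle_map {f : γ → δ} (h : (c.map f).Nodup) {a b : γ} (ha : a ∈ c)
    (hb : b ∈ c) (hab : f a = f b) : a = b := by
  induction c using Quotient.inductionOn with | _ l
  exact List.inj_on_of_nodup_map h ha hb hab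

lemma rel_of_cycle_chain {r R : γ → γ → Prop} [IsTrans γ R] (hc : c.Chain r)
    (hR : ∀ a ∈ c, ∀ b ∈ c, r a b → R a b) {a b : γ} (ha : a ∈ c) (hb : b ∈ c) : R a b := by
  refine Cycle.chain_iff_pairwise.1 ?_ a ha b hb
  induction c using Cycle.induction_on with
  | nil => trivial
  | cons a l =>
    have mem_of_mem {x : γ} (hx : x ∈ a :: (l ++ [a])) : x ∈ ((a :: l : List γ) : Cycle γ) := by
      simp only [List.mem_cons, List.mem_append, List.not_mem_nil, Cycle.mem_coe_iff] at hx ⊢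
      tauto
    rw [Cycle.chain_coe_cons] at hc ⊢
    exact hc.imp_of_mem_imp fun x y hx hy => hR x (mem_of_mem hx) y (mem_of_mem hy)

end CyclicSequences

section DirectedCycles

variable {α β : Type*} {G : Graph α β} {ref : RefOrientation G} {x y : V(G)}
  {d f : SignedEdge G} {l : List (SignedEdge G)} {c : Cycle (SignedEdge G)}

lemma opp_notMem_cycle (hc : (c.map Prod.fst).Nodup) (hd : d ∈ c) : opp d ∉ c := fun hd' => by
  have h_eq := congrArg Prod.snd (eq_of_nodup_cycle_map hc hd' hd rfl)
  simp at h_eq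

variable (ref) in
/-- The signed edges in `l` lead, one after the other, from `x` to `y`. -/
def IsTrail (x : V(G)) : List (SignedEdge G) → V(G) → Prop
  | [], y => x = y
  | d :: l, y => ref.src d = x ∧ IsTrail (ref.dst d) l y

namespace IsTrail

lemma of_append {l₁ l₂ : List (SignedEdge G)} (h : IsTrail ref x (l₁ ++ d :: l₂) y) :
    IsTrail ref (ref.src d) (d :: l₂) y := by
  induction l₁ generalizing x with
  | nil => exact ⟨rfl, h.2⟩
  | cons a l ih => exact ih h.2

lemma cons_map_dst (h : IsTrail ref x l y) : x :: l.map ref.dst = l.map ref.src ++ [y] := by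
  induction l generalizing x with
  | nil => exact congrArg (fun z => [z]) h
  | cons d l ih =>
    obtain ⟨rfl, h⟩ := h
    simp [ih h]

lemma isChain (h : IsTrail ref (ref.dst d) l (ref.src f)) :
    List.IsChain (fun d d' => ref.dst d = ref.src d') (d :: (l ++ [f])) := by
  induction l generalizing d with
  | nil =>
    have h_eq : ref.dst d = ref.src f := h
    simpa using h_eq
  | cons a l ih =>
    obtain ⟨ha, h⟩ := h
    rw [List.cons_append, List.isChain_cons_cons]
    exact ⟨ha.symm, ih h⟩

lemma nodup_map_fst (h : IsTrail ref x l y) (h_nodup : (l.map ref.src ++ [y]).Nodup) :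
    (l.map Prod.fst).Nodup := by
  induction l generalizing x with
  | nil => simp
  | cons d l ih =>
    obtain ⟨rfl, h⟩ := h
    rw [List.map_cons, List.cons_append, List.nodup_cons] at h_nodup
    rw [List.map_cons, List.nodup_cons]
    refine ⟨fun hd => ?_, ih h h_nodup.2⟩
    obtain ⟨g, hg, hgd⟩ := List.mem_map.1 hd
    rcases eq_or_eq_opp hgd with rfl | rfl
    · exact h_nodup.1 (List.mem_append_left _ (List.mem_map_of_mem hg))
    · refine h_nodup.1 (h.cons_map_dst ▸ List.mem_cons_of_mem _ ?_)
      simpa using List.mem_map_of_mem (f := ref.dst) hg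

end IsTrail

variable (ref) in
/-- A signed edge in `P` leads from `x` to `y`. -/
def IsStep (P : Set (SignedEdge G)) (x y : V(G)) : Prop :=
  ∃ d ∈ P, ref.src d = x ∧ ref.dst d = y

lemma exists_isTrail_nodup {P : Set (SignedEdge G)}
    (h : Relation.ReflTransGen (IsStep ref P) x y) :
    ∃ l, IsTrail ref x l y ∧ (∀ d ∈ l, d ∈ P) ∧ (l.map ref.src ++ [y]).Nodup := by
  induction h using Relation.ReflTransGen.head_induction_on with
  | refl => exact ⟨[], rfl, by simp, by simp⟩
  | head h_step _ ih =>
    obtain ⟨d, hd, rfl, rfl⟩ := h_step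
    obtain ⟨l, hl, hlP, h_nodup⟩ := ih
    by_cases h_src : ref.src d ∈ l.map ref.src ++ [y]
    · rw [List.mem_append, List.mem_singleton] at h_src
      rcases h_src with h_src | h_src
      · obtain ⟨g, hg, hgd⟩ := List.mem_map.1 h_src
        obtain ⟨l₁, l₂, rfl⟩ := List.append_of_mem hg
        refine ⟨g :: l₂, hgd ▸ hl.of_append, fun b hb => hlP b (List.mem_append_right _ hb), ?_⟩
        rw [List.map_append, List.append_assoc] at h_nodup
        exact (List.nodup_append.1 h_nodup).2.1
      · exact ⟨[], h_src, by simp, by simp⟩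
    · exact ⟨d :: l, ⟨rfl, hl⟩, List.forall_mem_cons.2 ⟨hd, hlP⟩,
        List.nodup_cons.2 ⟨h_src, h_nodup⟩⟩

variable [Fintype E(G)]

lemma exists_opp_mem_of_chain (hc : c.Chain fun d d' => ref.dst d = ref.src d') {X : Set V(G)}
    (hd : d ∈ c) (hX : d ∈ outEdges ref X) : ∃ g ∈ outEdges ref X, opp g ∈ c := by
  by_contra! h
  have stays_outside (b : SignedEdge G) (hb : b ∈ c) (hbX : ref.src b ∉ X) : ref.dst b ∉ X :=
    fun hbX' => h (opp b) (by simp [hbX, hbX']) (by simpa using hb)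
  let R (a b : SignedEdge G) : Prop := ref.dst a ∉ X → ref.src b ∉ X ∧ ref.dst b ∉ X
  have : IsTrans _ R := ⟨fun _ _ _ hab hbc ha => hbc (hab ha).2⟩
  have hR : R d d := rel_of_cycle_chain hc (fun a _ b hb hab ha => by
    have hbX : ref.src b ∉ X := hab ▸ ha
    exact ⟨hbX, stays_outside b hb hbX⟩) hd hd
  rw [mem_outEdges] at hX
  exact (hR hX.2).1 hX.1

variable [LinearOrder E(G)] {C D : Finset (SignedEdge G)} {T : SpanningSubgraph G}

lemma IsDirectedCut.opp_notMem (h : IsDirectedCut ref D) (hd : d ∈ D) : opp d ∉ D := by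
  obtain ⟨X, rfl⟩ := h.exists_eq
  rw [mem_outEdges] at hd
  simp [hd.1]

lemma IsDirectedCycle.opp_notMem (h : IsDirectedCycle ref D) (hd : d ∈ D) : opp d ∉ D := by
  obtain ⟨-, c, hc, rfl, -⟩ := h
  rw [mem_cycle_toFinset] at hd ⊢
  exact opp_notMem_cycle hc hd

lemma IsDirectedCut.exists_opp_mem (hC : IsDirectedCut ref C) (hD : IsDirectedCycle ref D)
    (hdC : d ∈ C) (hdD : d ∈ D) : ∃ g ∈ C, opp g ∈ D := by
  obtain ⟨X, rfl⟩ := hC.exists_eq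
  obtain ⟨-, c, -, rfl, hc⟩ := hD
  simp only [mem_cycle_toFinset] at hdD ⊢
  exact exists_opp_mem_of_chain hc hdD hdC

lemma exists_mem_ne_of_chain (hc : c.Chain fun d d' => ref.dst d = ref.src d')
    (h_fst : (c.map Prod.fst).Nodup) (hD : IsDirectedCut ref D) (hd : d ∈ D)
    (hdc : d.1 ∈ edges c.toFinset) : ∃ g ∈ D, g ≠ d ∧ g.1 ∈ edges c.toFinset := by
  have mem_edges_of_mem {g : SignedEdge G} (hg : g ∈ c) : g.1 ∈ edges c.toFinset :=
    mem_edges.2 ⟨g, mem_cycle_toFinset.2 hg, rfl⟩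
  obtain ⟨X, rfl⟩ := hD.exists_eq
  obtain ⟨a, ha, had⟩ := mem_edges.1 hdc
  rw [mem_cycle_toFinset] at ha
  rcases eq_or_eq_opp had with rfl | rfl
  · obtain ⟨g, hg, hgc⟩ := exists_opp_mem_of_chain hc ha hd
    refine ⟨g, hg, ?_, mem_edges_of_mem (g := opp g) hgc⟩
    rintro rfl
    exact opp_notMem_cycle h_fst ha hgc
  · obtain ⟨g, hg, hgc⟩ := exists_opp_mem_of_chain (X := Xᶜ) hc ha
      (opp_mem_outEdges.2 (by rwa [compl_compl]))
    refine ⟨opp g, opp_mem_outEdges.2 hg, ?_, mem_edges_of_mem hgc⟩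
    rintro rfl
    exact opp_notMem_cycle h_fst ha (by rwa [opp_opp])

variable [Finite V(G)]

lemma isCycle_iff (ref : RefOrientation G) :
    IsCycle T ↔ Minimal (fun S : SpanningSubgraph G => S.Nonempty ∧ ∀ D, IsDirectedCut ref D →
      ∀ d ∈ D, d.1 ∈ S → ∃ g ∈ D, g ≠ d ∧ g.1 ∈ S) T := by
  have h_iff (S : SpanningSubgraph G) : (∀ D, IsCut D → (D ∩ S).card ≠ 1) ↔
      ∀ D, IsDirectedCut ref D → ∀ d ∈ D, d.1 ∈ S → ∃ g ∈ D, g ≠ d ∧ g.1 ∈ S := by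
    constructor
    · intro h D hD d hd hdS
      by_contra! h_only
      refine h _ hD.1 (Finset.card_eq_one.2 ⟨d.1, Finset.eq_singleton_iff_unique_mem.2
        ⟨Finset.mem_inter.2 ⟨mem_edges.2 ⟨d, hd, rfl⟩, hdS⟩, fun e he => ?_⟩⟩)
      obtain ⟨he, heS⟩ := Finset.mem_inter.1 he
      obtain ⟨g, hg, rfl⟩ := mem_edges.1 he
      by_contra hgd
      exact h_only g hg (mt (congrArg Prod.fst) hgd) heS
    · intro h D hD h_card
      obtain ⟨e, he⟩ := Finset.card_eq_one.1 h_card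
      obtain ⟨heS, h_only⟩ := Finset.eq_singleton_iff_unique_mem.1 he
      rw [Finset.mem_inter] at heS
      obtain ⟨D', hD', hdD, rfl⟩ :=
        hD.exists_isDirectedCut (ref := ref) (d := (e, true)) heS.1
      obtain ⟨g, hg, hgd, hgS⟩ := h D' hD' _ hdD heS.2
      have hge : g.1 = e := h_only _ (Finset.mem_inter.2 ⟨mem_edges.2 ⟨g, hg, rfl⟩, hgS⟩)
      rcases eq_or_eq_opp (d := (e, true)) hge with rfl | rfl
      · exact hgd rfl
      · exact hD'.opp_notMem hdD hg
  simp only [IsCycle, h_iff]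

lemma fst_mem_of_dst_eq_src (h_src : (c.map ref.src).Nodup) (h_dst : (c.map ref.dst).Nodup)
    (hTc : T ⊆ edges c.toFinset)
    (hT : ∀ D, IsDirectedCut ref D → ∀ d ∈ D, d.1 ∈ T → ∃ g ∈ D, g ≠ d ∧ g.1 ∈ T)
    (hd : d ∈ c) (hf : f ∈ c) (hdf : ref.dst d = ref.src f) (hdT : d.1 ∈ T) : f.1 ∈ T := by
  by_contra hfT
  have h_ne : ref.src d ≠ ref.src f := fun h_eq =>
    hfT (eq_of_nodup_cycle_map h_src hd hf h_eq ▸ hdT)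
  obtain ⟨D, hD, hdD, hDf⟩ := exists_isDirectedCut_subset (ref := ref) (X := {ref.src f})
    (d := opp d) (by simp [hdf, h_ne])
  obtain ⟨g, hg, hgd, hgT⟩ := hT D hD _ hdD hdT
  obtain ⟨g', hg', hgg'⟩ := mem_edges.1 (hTc hgT)
  rw [mem_cycle_toFinset] at hg'
  have hgf : ref.src g = ref.src f := (mem_outEdges.1 (hDf hg)).1
  rcases eq_or_eq_opp hgg'.symm with rfl | rfl
  · exact hfT (eq_of_nodup_cycle_map h_src hg' hf hgf ▸ hgT)
  · rw [ref.src_opp, ← hdf] at hgf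
    exact hgd (congrArg opp (eq_of_nodup_cycle_map h_dst hg' hd hgf))

lemma isDirectedCycle_toFinset (hc : c.Chain fun d d' => ref.dst d = ref.src d')
    (h_nonempty : c.toFinset.Nonempty) (h_fst : (c.map Prod.fst).Nodup)
    (h_src : (c.map ref.src).Nodup) (h_dst : (c.map ref.dst).Nodup) :
    IsDirectedCycle ref c.toFinset := by
  refine ⟨(isCycle_iff ref).2 ⟨⟨h_nonempty.image _, fun D hD d hd hdc => ?_⟩, ?_⟩,
    c, h_fst, rfl, hc⟩
  · exact exists_mem_ne_of_chain hc h_fst hD hd hdc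
  rintro T ⟨⟨t, ht⟩, hT⟩ hTc
  obtain ⟨a, ha, rfl⟩ := mem_edges.1 (hTc ht)
  intro e he
  obtain ⟨b, hb, rfl⟩ := mem_edges.1 he
  have : IsTrans (SignedEdge G) fun a b => a.1 ∈ T → b.1 ∈ T :=
    ⟨fun _ _ _ hab hbc ha => hbc (hab ha)⟩
  rw [mem_cycle_toFinset] at ha hb
  exact rel_of_cycle_chain (R := fun a b : SignedEdge G => a.1 ∈ T → b.1 ∈ T) hc
    (fun _ ha _ hb => fst_mem_of_dst_eq_src h_src h_dst hTc hT ha hb) ha hb ht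

lemma isDirectedCycle_of_isTrail (h : IsTrail ref (ref.dst f) l (ref.src f))
    (h_nodup : (l.map ref.src ++ [ref.src f]).Nodup) (hf : ∀ d ∈ l, d.1 ≠ f.1) :
    IsDirectedCycle ref ((f :: l : List (SignedEdge G)) : Cycle (SignedEdge G)).toFinset := by
  refine isDirectedCycle_toFinset ?_ ⟨f, by simp⟩ ?_ ?_ ?_
  · rw [Cycle.chain_coe_cons]
    exact h.isChain
  · rw [Cycle.map_coe, Cycle.nodup_coe_iff, List.map_cons, List.nodup_cons, List.mem_map]
    exact ⟨fun ⟨d, hd, hdf⟩ => hf d hd hdf, h.nodup_map_fst h_nodup⟩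
  · rw [Cycle.map_coe, Cycle.nodup_coe_iff, List.map_cons]
    exact (List.perm_append_singleton _ _).nodup_iff.1 h_nodup
  · rwa [Cycle.map_coe, Cycle.nodup_coe_iff, List.map_cons, h.cons_map_dst]

lemma exists_isDirectedCycle_or_isDirectedCut (ref : RefOrientation G)
    (P : Set (SignedEdge G)) (f : SignedEdge G) :
    (∃ D, IsDirectedCycle ref D ∧ f ∈ D ∧ ∀ g ∈ D, g = f ∨ g ∈ P) ∨
      ∃ D, IsDirectedCut ref D ∧ f ∈ D ∧ ∀ g ∈ D, g = f ∨ g ∈ dual P := by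
  let Reachable : V(G) → Prop :=
    Relation.ReflTransGen (IsStep ref {d | d ∈ P ∧ d.1 ≠ f.1}) (ref.dst f)
  by_cases h : Reachable (ref.src f)
  · obtain ⟨l, hl, hlP, h_nodup⟩ := exists_isTrail_nodup h
    refine Or.inl ⟨_, isDirectedCycle_of_isTrail hl h_nodup fun d hd => (hlP d hd).2, by simp,
      fun g hg => ?_⟩
    rw [mem_cycle_toFinset, Cycle.mem_coe_iff, List.mem_cons] at hg
    exact hg.imp_right fun hg => (hlP g hg).1
  · have hf : f ∈ outEdges ref {x | Reachable x}ᶜ := by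
      simpa using ⟨h, Relation.ReflTransGen.refl⟩
    obtain ⟨D, hD, hfD, hDX⟩ := exists_isDirectedCut_subset hf
    refine Or.inr ⟨D, hD, hfD, fun g hg => or_iff_not_imp_left.2 fun hgf hgP => ?_⟩
    have hg_out : ¬ Reachable (ref.src g) ∧ Reachable (ref.dst g) := by
      simpa using mem_outEdges.1 (hDX hg)
    have hg_fst : g.1 ≠ f.1 := fun h_eq =>
      (eq_or_eq_opp h_eq).elim hgf fun h_opp => hD.opp_notMem hfD (h_opp ▸ hg)
    exact hg_out.1 (hg_out.2.tail ⟨opp g, ⟨hgP, hg_fst⟩, by simp, by simp⟩)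

lemma isDualPair (ref : RefOrientation G) :
    IsDualPair (IsDirectedCut ref) (IsDirectedCycle ref) where
  opp_notMem_left := IsDirectedCut.opp_notMem
  opp_notMem_right := IsDirectedCycle.opp_notMem
  orthogonal := IsDirectedCut.exists_opp_mem
  painting := exists_isDirectedCycle_or_isDirectedCut ref

lemma IsCycle.exists_isDirectedCycle (h : IsCycle T) (hd : d.1 ∈ T) :
    ∃ D, IsDirectedCycle ref D ∧ d ∈ D ∧ edges D = T := by
  rcases exists_isDirectedCycle_or_isDirectedCut ref {g | g.1 ∈ T} d with
    ⟨D, hD, hdD, hDT⟩ | ⟨D, hD, hdD, hDT⟩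
  · have h_sub : edges D ⊆ T := by
      intro e he
      obtain ⟨g, hg, rfl⟩ := mem_edges.1 he
      exact (hDT g hg).elim (fun h_eq => h_eq ▸ hd) id
    exact ⟨D, hD, hdD, h_sub.antisymm (h.2 hD.1.1 h_sub)⟩
  · obtain ⟨g, hg, hgd, hgT⟩ := ((isCycle_iff ref).1 h).1.2 D hD d hdD hd
    exact absurd hgT ((hDT g hg).resolve_left hgd)

end DirectedCycles

section ActivityMaps

variable {α β : Type*} {G : Graph α β} {ref : RefOrientation G}

lemma isLeast_edges_iff [LinearOrder E(G)] {D : Finset (SignedEdge G)} {d : SignedEdge G}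
    (hd : d ∈ D) : IsLeast (edges D : Set E(G)) d.1 ↔ ∀ g ∈ D, d.1 ≤ g.1 := by
  simp only [IsLeast, lowerBounds, Finset.mem_coe, mem_edges]
  exact ⟨fun h g hg => h.2 ⟨g, hg, rfl⟩,
    fun h => ⟨⟨d, hd, rfl⟩, fun _ ⟨g, hg, hge⟩ => hge ▸ h g hg⟩⟩

variable [Fintype E(G)] [LinearOrder E(G)] {O : Four G} {S : SpanningSubgraph G} {e : E(G)}
  {s : Bool}

lemma mem_posEdges : e ∈ posEdges O ↔ (e, true) ∈ O ∧ (e, false) ∉ O := by simp [posEdges]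

lemma mem_negEdges : e ∈ negEdges O ↔ (e, false) ∈ O ∧ (e, true) ∉ O := by simp [negEdges]

lemma mem_unorientedEdges : e ∈ unorientedEdges O ↔ (e, true) ∉ O ∧ (e, false) ∉ O := by
  simp [unorientedEdges]

lemma mem_biorientedEdges : e ∈ biorientedEdges O ↔ (e, true) ∈ O ∧ (e, false) ∈ O := by
  simp [biorientedEdges]

lemma mem_orientedEdges : e ∈ orientedEdges O ↔ ¬ ((e, true) ∈ O ↔ (e, false) ∈ O) := by
  simp only [orientedEdges, Finset.mem_union, mem_posEdges, mem_negEdges]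
  tauto

lemma exists_mem_of_mem_orientedEdges (h : e ∈ orientedEdges O) :
    ∃ s, (e, s) ∈ O ∧ (e, !s) ∉ O := by
  rw [mem_orientedEdges] at h
  rw [Bool.exists_bool, Bool.not_true, Bool.not_false]
  tauto

lemma mem_orientedCutActive :
    e ∈ orientedCutActive ref O ↔ e ∈ orientedEdges O ∧ IsMinOfPotentialCut ref O e := by
  simp only [orientedCutActive, Finset.mem_filter]

lemma mem_orientedCycleActive :
    e ∈ orientedCycleActive ref O ↔ e ∈ orientedEdges O ∧ IsMinOfPotentialCycle ref O e := by
  simp only [orientedCycleActive, Finset.mem_filter]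

-- In the next four proofs `congr!` identifies the classical decidability of equality in the
-- definition with the one that the order provides.
lemma mem_cutActive : e ∈ cutActive S ↔
    ∃ C : SpanningSubgraph G, IsCut C ∧ Disjoint C (S.erase e) ∧ IsLeast (C : Set E(G)) e := by
  simp only [cutActive, Finset.mem_filter, Finset.mem_univ, true_and]
  congr!

lemma mem_cycleActive : e ∈ cycleActive S ↔
    ∃ C : SpanningSubgraph G, IsCycle C ∧ C ⊆ insert e S ∧ IsLeast (C : Set E(G)) e := by
  simp only [cycleActive, Finset.mem_filter, Finset.mem_univ, true_and]
  congr!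

lemma mem_unorientedCutActive {σu : E(G) → Bool} : e ∈ unorientedCutActive ref σu O ↔
    e ∈ unorientedEdges O ∧ IsMinOfPotentialCut ref (insert (e, σu e) O) e := by
  simp only [unorientedCutActive, Finset.mem_filter]
  congr!

lemma mem_biorientedCycleActive {σb : E(G) → Bool} : e ∈ biorientedCycleActive ref σb O ↔
    e ∈ biorientedEdges O ∧ IsMinOfPotentialCycle ref (O.erase (e, σb e)) e := by
  simp only [biorientedCycleActive, Finset.mem_filter]
  congr!

lemma isMinOfPotentialCut_iff : IsMinOfPotentialCut ref O e ↔
    ∃ s, IsMinIn (IsDirectedCut ref) (dual (O : Set (SignedEdge G))) (e, s) := by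
  constructor
  · rintro ⟨D, ⟨hD, hDO⟩, he⟩
    obtain ⟨d, hd, rfl⟩ := mem_edges.1 he.1
    exact ⟨d.2, D, hD, hd, (isLeast_edges_iff hd).1 he, hDO⟩
  · rintro ⟨s, D, hD⟩
    exact ⟨D, ⟨hD.family, hD.subset⟩, (isLeast_edges_iff hD.mem).2 hD.le⟩

lemma isMinOfPotentialCycle_iff : IsMinOfPotentialCycle ref O e ↔
    ∃ s, IsMinIn (IsDirectedCycle ref) (O : Set (SignedEdge G)) (e, s) := by
  constructor
  · rintro ⟨D, ⟨hD, hDO⟩, he⟩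
    obtain ⟨d, hd, rfl⟩ := mem_edges.1 he.1
    exact ⟨d.2, D, hD, hd, (isLeast_edges_iff hd).1 he, hDO⟩
  · rintro ⟨s, D, hD⟩
    exact ⟨D, ⟨hD.family, hD.subset⟩, (isLeast_edges_iff hD.mem).2 hD.le⟩

lemma isMinOfPotentialCut_iff_of_mem (he : (e, s) ∈ O) : IsMinOfPotentialCut ref O e ↔
    IsMinIn (IsDirectedCut ref) (dual (O : Set (SignedEdge G))) (e, s) := by
  rw [isMinOfPotentialCut_iff, exists_isMinIn_iff]
  simpa using he

lemma isMinOfPotentialCycle_iff_of_notMem (he : (e, !s) ∉ O) : IsMinOfPotentialCycle ref O e ↔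
    IsMinIn (IsDirectedCycle ref) (O : Set (SignedEdge G)) (e, s) := by
  rw [isMinOfPotentialCycle_iff, exists_isMinIn_iff]
  exact he

lemma isMinOfPotentialCut_insert_iff (he : ∀ t, (e, t) ∉ O) :
    IsMinOfPotentialCut ref (insert (e, s) O) e ↔
      IsMinIn (IsDirectedCut ref) (dual (O : Set (SignedEdge G))) (e, s) := by
  rw [isMinOfPotentialCut_iff_of_mem (Finset.mem_insert_self _ _),
    ← isMinIn_setState_singleton_iff IsDirectedCut.opp_notMem (by simp [he]),
    ← isMinIn_setState_singleton_iff IsDirectedCut.opp_notMem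
      (show (e, s) ∈ dual (O : Set (SignedEdge G)) by simp [he])]
  refine isMinIn_setState_congr fun g hg => not_congr ?_
  have : opp g ≠ (e, s) := fun h => hg.ne' (congrArg Prod.fst h)
  simp [this]

lemma isMinOfPotentialCycle_erase_iff (he : (e, s) ∈ O) :
    IsMinOfPotentialCycle ref (O.erase (e, !s)) e ↔
      IsMinIn (IsDirectedCycle ref) (O : Set (SignedEdge G)) (e, s) := by
  rw [isMinOfPotentialCycle_iff_of_notMem (Finset.notMem_erase _ _),
    ← isMinIn_setState_singleton_iff IsDirectedCycle.opp_notMem (by simp [he]),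
    ← isMinIn_setState_singleton_iff IsDirectedCycle.opp_notMem (Finset.mem_coe.2 he)]
  refine isMinIn_setState_congr fun g hg => ?_
  have : g ≠ (e, !s) := fun h => hg.ne' (congrArg Prod.fst h)
  simp [this]

lemma card_filter_eq_of_bijective {φ : Four G → SpanningSubgraph G}
    (h : Function.Bijective fun O : Four G => (φ O, orientedEdges O)) (S : SpanningSubgraph G) :
    (Finset.univ.filter fun O => φ O = S).card = 2 ^ Fintype.card E(G) := by
  rw [← Fintype.card_finset, ← Finset.card_univ]
  refine Finset.card_bij (fun O _ => orientedEdges O) (fun _ _ => Finset.mem_univ _)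
    (fun O hO O' hO' hOO' => ?_) fun T _ => ?_
  · rw [Finset.mem_filter_univ] at hO hO'
    exact h.1 (Prod.ext (hO.trans hO'.symm) hOO')
  · obtain ⟨O, hO⟩ := h.2 (S, T)
    rw [Prod.ext_iff] at hO
    exact ⟨O, (Finset.mem_filter_univ _).2 hO.1, hO.2⟩

variable (ref) in
/-- The relation between a fourientation `O` and the spanning subgraph `S` to which the activity map
takes it. The label `σb e` is negated because it names the direction of a bioriented edge that is
removed, whereas `IsContraction` takes the direction that is kept. -/
def IsActivityContraction (σu σb : E(G) → Bool) (O : Four G) (S : SpanningSubgraph G) : Prop :=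
  IsContraction (IsDirectedCut ref) (IsDirectedCycle ref) σu (fun e => !σb e)
    (O : Set (SignedEdge G)) (S : Set E(G))

variable {σu σb : E(G) → Bool}

lemma IsActivityContraction.mem_iff_of_notMem_orientedEdges
    (hS : IsActivityContraction ref σu σb O S) (he : e ∉ orientedEdges O) :
    e ∈ S ↔ e ∈ biorientedEdges O := by
  rw [mem_orientedEdges, not_not] at he
  have h_iff (t : Bool) : (e, t) ∈ O ↔ e ∈ biorientedEdges O := by
    cases t <;> simp [mem_biorientedEdges, he]
  exact (hS e).trans (h_iff _)

lemma exists_isActivityContraction (ref : RefOrientation G) (σu σb : E(G) → Bool) (O : Four G) :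
    ∃ S, IsActivityContraction ref σu σb O S := by
  obtain ⟨S, hS⟩ := exists_isContraction (IsDirectedCut ref) (IsDirectedCycle ref) σu
    (fun e => !σb e) (O : Set (SignedEdge G))
  exact ⟨S.toFinite.toFinset, by rwa [IsActivityContraction, Set.Finite.coe_toFinset]⟩

lemma bijective_of_isActivityContraction {φ : Four G → SpanningSubgraph G}
    (hφ : ∀ O, IsActivityContraction ref σu σb O (φ O)) :
    Function.Bijective fun O : Four G => (φ O, orientedEdges O) := by
  rw [Fintype.bijective_iff_injective_and_card]
  constructor
  · intro O O' h
    rw [Prod.ext_iff] at h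
    have hO' : IsActivityContraction ref σu σb O' (φ O) :=
      (show φ O = φ O' from h.1) ▸ hφ O'
    refine Finset.coe_injective (IsContraction.eq_of_simple_iff (hφ O) hO' fun e => ?_)
    have h_iff := Finset.ext_iff.1 h.2 e
    rwa [mem_orientedEdges, mem_orientedEdges, not_iff_not] at h_iff
  · simp only [Fintype.card_finset, Fintype.card_prod, Fintype.card_bool]
    ring

variable [Finite V(G)]

lemma mem_cutActive_iff_isMinIn (ref : RefOrientation G) (s : Bool) : e ∈ cutActive S ↔
    IsMinIn (IsDirectedCut ref) (setState (dual (Prod.fst ⁻¹' (S : Set E(G)))) e {s}) (e, s) := by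
  rw [mem_cutActive]
  constructor
  · rintro ⟨C, hC, hCS, he⟩
    obtain ⟨D, hD, hdD, rfl⟩ := hC.exists_isDirectedCut (ref := ref) (d := (e, s)) he.1
    refine ⟨D, hD, hdD, (isLeast_edges_iff hdD).1 he,
      (subset_setState_singleton_iff (hD.opp_notMem hdD)).2 fun g hg hge hgS => ?_⟩
    exact Finset.disjoint_left.1 hCS (mem_edges.2 ⟨g, hg, rfl⟩) (Finset.mem_erase.2 ⟨hge, hgS⟩)
  · rintro ⟨D, hD⟩
    refine ⟨edges D, hD.family.1, Finset.disjoint_left.2 fun f hf hfS => ?_,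
      (isLeast_edges_iff hD.mem).2 hD.le⟩
    obtain ⟨g, hg, rfl⟩ := mem_edges.1 hf
    rw [Finset.mem_erase] at hfS
    exact (mem_setState_of_ne hfS.1).1 (hD.subset g hg) hfS.2

lemma mem_cycleActive_iff_isMinIn (ref : RefOrientation G) (s : Bool) : e ∈ cycleActive S ↔
    IsMinIn (IsDirectedCycle ref) (setState (Prod.fst ⁻¹' (S : Set E(G))) e {s}) (e, s) := by
  rw [mem_cycleActive]
  constructor
  · rintro ⟨C, hC, hCS, he⟩
    obtain ⟨D, hD, hdD, rfl⟩ := hC.exists_isDirectedCycle (ref := ref) (d := (e, s)) he.1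
    refine ⟨D, hD, hdD, (isLeast_edges_iff hdD).1 he,
      (subset_setState_singleton_iff (hD.opp_notMem hdD)).2 fun g hg hge => ?_⟩
    exact (Finset.mem_insert.1 (hCS (mem_edges.2 ⟨g, hg, rfl⟩))).resolve_left hge
  · rintro ⟨D, hD⟩
    refine ⟨edges D, hD.family.1, fun f hf => ?_, (isLeast_edges_iff hD.mem).2 hD.le⟩
    obtain ⟨g, hg, rfl⟩ := mem_edges.1 hf
    exact Finset.mem_insert.2 (or_iff_not_imp_left.2 fun hge =>
      (mem_setState_of_ne hge).1 (hD.subset g hg))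

namespace IsActivityContraction

lemma mem_cutActive_iff (hS : IsActivityContraction ref σu σb O S)
    (he : (e, !dirOf σu (O : Set (SignedEdge G)) e) ∉ O) :
    e ∈ cutActive S ↔ IsMinIn (IsDirectedCut ref) (dual (O : Set (SignedEdge G)))
      (e, dirOf σu (O : Set (SignedEdge G)) e) := by
  rw [mem_cutActive_iff_isMinIn ref, IsContraction.isMinIn_left_iff hS (isDualPair ref) he]

lemma mem_cycleActive_iff (hS : IsActivityContraction ref σu σb O S)
    (he : (e, dirOf (fun e => !σb e) (O : Set (SignedEdge G)) e) ∈ O) :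
    e ∈ cycleActive S ↔ IsMinIn (IsDirectedCycle ref) (O : Set (SignedEdge G))
      (e, dirOf (fun e => !σb e) (O : Set (SignedEdge G)) e) := by
  rw [mem_cycleActive_iff_isMinIn ref, IsContraction.isMinIn_right_iff hS (isDualPair ref) he]

lemma cutActive_inter_orientedEdges (hS : IsActivityContraction ref σu σb O S) :
    cutActive S ∩ orientedEdges O = orientedCutActive ref O := by
  ext e
  rw [Finset.mem_inter, mem_orientedCutActive, and_comm]
  refine and_congr_right fun he => ?_
  obtain ⟨s, hs, hs'⟩ := exists_mem_of_mem_orientedEdges he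
  have h_dir := dirOf_eq (τ := σu) (P := (O : Set (SignedEdge G))) hs hs'
  rw [hS.mem_cutActive_iff (by rwa [h_dir]), h_dir, isMinOfPotentialCut_iff_of_mem hs]

lemma cutActive_inter_unorientedEdges (hS : IsActivityContraction ref σu σb O S) :
    cutActive S ∩ unorientedEdges O = unorientedCutActive ref σu O := by
  ext e
  rw [Finset.mem_inter, mem_unorientedCutActive, and_comm]
  refine and_congr_right fun he => ?_
  rw [mem_unorientedEdges] at he
  have h_notMem : ∀ t, (e, t) ∉ O := Bool.forall_bool.2 he.symm
  have h_dir := dirOf_eq_label (τ := σu) (P := (O : Set (SignedEdge G)))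
    (iff_of_false he.1 he.2)
  rw [hS.mem_cutActive_iff (h_notMem _), h_dir, isMinOfPotentialCut_insert_iff h_notMem]

lemma cycleActive_inter_orientedEdges (hS : IsActivityContraction ref σu σb O S) :
    cycleActive S ∩ orientedEdges O = orientedCycleActive ref O := by
  ext e
  rw [Finset.mem_inter, mem_orientedCycleActive, and_comm]
  refine and_congr_right fun he => ?_
  obtain ⟨s, hs, hs'⟩ := exists_mem_of_mem_orientedEdges he
  have h_dir := dirOf_eq (τ := fun e => !σb e) (P := (O : Set (SignedEdge G))) hs hs'
  rw [hS.mem_cycleActive_iff (by rwa [h_dir]), h_dir, isMinOfPotentialCycle_iff_of_notMem hs']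

lemma cycleActive_inter_biorientedEdges (hS : IsActivityContraction ref σu σb O S) :
    cycleActive S ∩ biorientedEdges O = biorientedCycleActive ref σb O := by
  ext e
  rw [Finset.mem_inter, mem_biorientedCycleActive, and_comm]
  refine and_congr_right fun he => ?_
  rw [mem_biorientedEdges] at he
  have h_mem : ∀ t, (e, t) ∈ O := Bool.forall_bool.2 he.symm
  have h_dir := dirOf_eq_label (τ := fun e => !σb e) (P := (O : Set (SignedEdge G)))
    (iff_of_true he.1 he.2)
  rw [hS.mem_cycleActive_iff (h_mem _), h_dir, ← isMinOfPotentialCycle_erase_iff (h_mem _),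
    Bool.not_not]

lemma mem_iff_of_mem_cutActive (hS : IsActivityContraction ref σu σb O S)
    (he : e ∈ cutActive S) : e ∈ S ↔ (e, true) ∈ O :=
  IsContraction.mem_iff_of_left hS fun s => (mem_cutActive_iff_isMinIn ref s).1 he

lemma mem_iff_of_mem_cycleActive (hS : IsActivityContraction ref σu σb O S)
    (he : e ∈ cycleActive S) : e ∈ S ↔ (e, false) ∈ O :=
  IsContraction.mem_iff_of_right hS (isDualPair ref)
    fun s => (mem_cycleActive_iff_isMinIn ref s).1 he

end IsActivityContraction

lemma isActivityMap_of_isActivityContraction {φ : Four G → SpanningSubgraph G}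
    (hφ : ∀ O, IsActivityContraction ref σu σb O (φ O)) : IsActivityMap ref σu σb φ := by
  have h_bij := bijective_of_isActivityContraction hφ
  have eq_biorientedEdges (O : Four G) (hO : orientedEdges O = ∅) : φ O = biorientedEdges O :=
    Finset.ext fun e => (hφ O).mem_iff_of_notMem_orientedEdges (by simp [hO])
  refine
  { card_fiber := card_filter_eq_of_bijective h_bij
    bijective := h_bij
    unoriented_disjoint := fun O => Finset.disjoint_left.2 fun e he => ?_
    bioriented_subset := fun O e he => ?_
    cut_oriented := fun O => (hφ O).cutActive_inter_orientedEdges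
    cut_unoriented := fun O => (hφ O).cutActive_inter_unorientedEdges
    cycle_oriented := fun O => (hφ O).cycleActive_inter_orientedEdges
    cycle_bioriented := fun O => (hφ O).cycleActive_inter_biorientedEdges
    cut_pos_subset := fun O e he => ?_
    cut_neg_disjoint := fun O => Finset.disjoint_left.2 fun e he => ?_
    cycle_neg_subset := fun O e he => ?_
    cycle_pos_disjoint := fun O => Finset.disjoint_left.2 fun e he => ?_
    cut_of_not_oriented := fun O hO => congrArg cutActive (eq_biorientedEdges O hO)
    cycle_of_not_oriented := fun O hO => congrArg cycleActive (eq_biorientedEdges O hO) }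
  · rw [mem_unorientedEdges] at he
    rw [(hφ O).mem_iff_of_notMem_orientedEdges (by simp [mem_orientedEdges, he])]
    simp [mem_biorientedEdges, he]
  · rw [(hφ O).mem_iff_of_notMem_orientedEdges]
    · exact he
    · rw [mem_biorientedEdges] at he
      simp [mem_orientedEdges, he]
  · rw [Finset.mem_inter, mem_posEdges] at he
    exact ((hφ O).mem_iff_of_mem_cutActive he.1).2 he.2.1
  · rw [Finset.mem_inter, mem_negEdges] at he
    exact mt ((hφ O).mem_iff_of_mem_cutActive he.1).1 he.2.2
  · rw [Finset.mem_inter, mem_negEdges] at he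
    exact ((hφ O).mem_iff_of_mem_cycleActive he.1).2 he.2.1
  · rw [Finset.mem_inter, mem_posEdges] at he
    exact mt ((hφ O).mem_iff_of_mem_cycleActive he.1).1 he.2.2

lemma exists_isActivityMap (ref : RefOrientation G) (σu σb : E(G) → Bool) :
    ∃ φ, IsActivityMap ref σu σb φ := by
  choose φ hφ using exists_isActivityContraction ref σu σb
  exact ⟨φ, isActivityMap_of_isActivityContraction hφ⟩

end ActivityMaps

section Counting

variable {α β : Type*} {G : Graph α β} {S U : SpanningSubgraph G} {x y : V(G)}
  {d : SignedEdge G}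

lemma numComponents_empty : numComponents (∅ : SpanningSubgraph G) = Nat.card V(G) := by
  let toVertex : Component (∅ : SpanningSubgraph G) → V(G) :=
    Quot.lift id fun _ _ ⟨e, he, _⟩ => absurd he (Finset.notMem_empty e)
  exact (Nat.card_eq_of_bijective (Quot.mk _)
    ⟨fun _ _ h => congrArg toVertex h, Quot.mk_surjective⟩).symm

section InsertEdge

variable [DecidableEq E(G)] {ref : RefOrientation G}

lemma Joined.of_insert_of_joined (h : Joined (insert d.1 S) x y)
    (hd : Joined S (ref.src d) (ref.dst d)) : Joined S x y := by
  refine (h.mem_iff_of_closed (ref := ref) (X := {v | Joined S x v})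
    fun g hg h_src => ?_).1 (.refl S x)
  rcases Finset.mem_insert.1 hg with hgd | hgS
  · rcases eq_or_eq_opp hgd with rfl | rfl
    · exact h_src.trans hd
    · rw [ref.src_opp] at h_src
      rw [ref.dst_opp]
      exact h_src.trans hd.symm
  · exact h_src.trans (ref.joined hgS)

lemma Joined.of_insert_of_not_joined (h : Joined (insert d.1 S) x y)
    (hx : ¬ Joined S (ref.src d) x) (hy : ¬ Joined S (ref.src d) y) : Joined S x y := by
  let X : Set V(G) := {v | Joined S x v ∨ Joined S x (ref.dst d) ∧ Joined S (ref.src d) v}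
  suffices hX : ∀ g : SignedEdge G, g.1 ∈ insert d.1 S → ref.src g ∈ X → ref.dst g ∈ X from
    ((h.mem_iff_of_closed hX).1 (Or.inl (.refl S x))).resolve_right fun hy' => hy hy'.2
  intro g hg h_src
  rcases Finset.mem_insert.1 hg with hgd | hgS
  · rcases eq_or_eq_opp hgd with rfl | rfl
    · rcases h_src with h_src | h_src
      · exact absurd h_src.symm hx
      · exact Or.inl h_src.1
    · rw [ref.src_opp] at h_src
      rw [ref.dst_opp]
      exact Or.inr ⟨h_src.elim id And.left, .refl S _⟩
  · have h_joined := ref.joined hgS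
    exact h_src.imp (·.trans h_joined) (And.imp_right (·.trans h_joined))

lemma numComponents_insert_of_joined (hd : Joined S (ref.src d) (ref.dst d)) :
    numComponents (insert d.1 S) = numComponents S := by
  refine (Nat.card_eq_of_bijective (Component.map (Finset.subset_insert d.1 S))
    ⟨?_, Component.map_surjective _⟩).symm
  rintro ⟨x⟩ ⟨y⟩ hxy
  exact Joined.of_insert_of_joined hxy hd

lemma numComponents_insert_of_not_joined [Finite V(G)]
    (hd : ¬ Joined S (ref.src d) (ref.dst d)) :
    numComponents (insert d.1 S) + 1 = numComponents S := by
  let c : Component S := Quot.mk _ (ref.src d)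
  let f (a : ({c}ᶜ : Set (Component S))) : Component (insert d.1 S) :=
    Component.map (Finset.subset_insert d.1 S) a
  have hf : Function.Bijective f := by
    constructor
    · rintro ⟨⟨x⟩, hx⟩ ⟨⟨y⟩, hy⟩ hxy
      exact Subtype.ext (Joined.of_insert_of_not_joined hxy (mt Eq.symm hx) (mt Eq.symm hy))
    · rintro ⟨x⟩
      by_cases hx : Joined S x (ref.src d)
      · refine ⟨⟨Quot.mk _ (ref.dst d), mt Eq.symm hd⟩, ?_⟩
        have h_insert : Joined (insert d.1 S) (ref.src d) (ref.dst d) :=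
          ref.joined (Finset.mem_insert_self d.1 S)
        exact ((hx.mono (Finset.subset_insert d.1 S)).trans h_insert).symm
      · exact ⟨⟨Quot.mk _ x, hx⟩, rfl⟩
  have h_card := Set.ncard_add_ncard_compl ({c} : Set (Component S))
  rwa [Set.ncard_singleton, ← Nat.card_coe_set_eq, Nat.card_eq_of_bijective f hf,
    add_comm] at h_card

end InsertEdge

variable [Fintype E(G)] [LinearOrder E(G)] [Finite V(G)] {ref : RefOrientation G}

lemma not_joined_src_dst_iff : ¬ Joined S (ref.src d) (ref.dst d) ↔
    ∃ D, IsDirectedCut ref D ∧ d ∈ D ∧ Disjoint (edges D) S := by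
  rw [not_joined_iff ref]
  constructor
  · rintro ⟨X, h_src, h_dst, hX⟩
    obtain ⟨D, hD, hdD, hDX⟩ := exists_isDirectedCut_subset (mem_outEdges.2 ⟨h_src, h_dst⟩)
    refine ⟨D, hD, hdD, Finset.disjoint_left.2 fun e he => ?_⟩
    obtain ⟨g, hg, rfl⟩ := mem_edges.1 he
    exact hX g (hDX hg)
  · rintro ⟨D, hD, hdD, hDS⟩
    obtain ⟨X, rfl⟩ := hD.exists_eq
    obtain ⟨h_src, h_dst⟩ := mem_outEdges.1 hdD
    exact ⟨X, h_src, h_dst, fun g hg => Finset.disjoint_left.1 hDS (mem_edges.2 ⟨g, hg, rfl⟩)⟩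

lemma joined_src_dst_iff (hd : d.1 ∉ S) : Joined S (ref.src d) (ref.dst d) ↔
    ∃ D, IsDirectedCycle ref D ∧ d ∈ D ∧ edges D ⊆ insert d.1 S := by
  constructor
  · intro h
    rcases exists_isDirectedCycle_or_isDirectedCut ref {g | g.1 ∈ S} d with
      ⟨D, hD, hdD, hDS⟩ | ⟨D, hD, hdD, hDS⟩
    · refine ⟨D, hD, hdD, fun e he => ?_⟩
      obtain ⟨g, hg, rfl⟩ := mem_edges.1 he
      exact Finset.mem_insert.2 ((hDS g hg).imp_left (congrArg Prod.fst))
    · refine absurd h (not_joined_src_dst_iff.2 ⟨D, hD, hdD, Finset.disjoint_left.2 fun e he => ?_⟩)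
      obtain ⟨g, hg, rfl⟩ := mem_edges.1 he
      exact (hDS g hg).elim (fun h_eq => h_eq ▸ hd) id
  · rintro ⟨D, hD, hdD, hDS⟩
    by_contra h
    obtain ⟨C, hC, hdC, hCS⟩ := not_joined_src_dst_iff.1 h
    obtain ⟨g, hg, hgD⟩ := hC.exists_opp_mem hD hdC hdD
    rcases Finset.mem_insert.1 (hDS (mem_edges.2 ⟨_, hgD, rfl⟩)) with hgd | hgS
    · rcases eq_or_eq_opp hgd with h_eq | h_eq
      · exact hC.opp_notMem hg (h_eq ▸ hdC)
      · exact hD.opp_notMem hdD (h_eq ▸ hgD)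
    · exact Finset.disjoint_left.1 hCS (mem_edges.2 ⟨g, hg, rfl⟩) hgS

lemma mem_cutActive_iff_not_joined (hd : d.1 ∉ S) (hU : ∀ f, f ∈ U ↔ f < d.1) :
    d.1 ∈ cutActive S ↔ ¬ Joined (S ∪ U) (ref.src d) (ref.dst d) := by
  rw [mem_cutActive, not_joined_src_dst_iff, Finset.erase_eq_of_notMem hd]
  constructor
  · rintro ⟨C, hC, hCS, hdC, h_min⟩
    obtain ⟨D, hD, hdD, rfl⟩ := hC.exists_isDirectedCut (ref := ref) hdC
    exact ⟨D, hD, hdD, Finset.disjoint_union_right.2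
      ⟨hCS, Finset.disjoint_left.2 fun f hf hfU => (h_min hf).not_gt ((hU f).1 hfU)⟩⟩
  · rintro ⟨D, hD, hdD, hDSU⟩
    rw [Finset.disjoint_union_right] at hDSU
    exact ⟨edges D, hD.1, hDSU.1, mem_edges.2 ⟨d, hdD, rfl⟩, fun f hf =>
      not_lt.1 fun hlt => Finset.disjoint_left.1 hDSU.2 hf ((hU f).2 hlt)⟩

lemma mem_cycleActive_iff_joined (hd : d.1 ∈ S) (hU : ∀ f, f ∈ U ↔ d.1 < f) :
    d.1 ∈ cycleActive S ↔ Joined (S ∩ U) (ref.src d) (ref.dst d) := by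
  have hdU : d.1 ∉ S ∩ U := fun h => lt_irrefl _ ((hU _).1 (Finset.mem_inter.1 h).2)
  rw [mem_cycleActive, joined_src_dst_iff hdU, Finset.insert_eq_of_mem hd]
  constructor
  · rintro ⟨C, hC, hCS, hdC, h_min⟩
    obtain ⟨D, hD, hdD, rfl⟩ := hC.exists_isDirectedCycle (ref := ref) hdC
    refine ⟨D, hD, hdD, fun f hf => ?_⟩
    rw [Finset.mem_insert, Finset.mem_inter, hU]
    exact (h_min hf).eq_or_lt.imp Eq.symm fun h => ⟨hCS hf, h⟩
  · rintro ⟨D, hD, hdD, hDSU⟩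
    refine ⟨edges D, hD.1, fun f hf => ?_, mem_edges.2 ⟨d, hdD, rfl⟩, fun f hf => ?_⟩
    · rcases Finset.mem_insert.1 (hDSU hf) with rfl | h
      · exact hd
      · exact (Finset.mem_inter.1 h).1
    · rcases Finset.mem_insert.1 (hDSU hf) with rfl | h
      · exact le_rfl
      · exact ((hU f).1 (Finset.mem_inter.1 h).2).le

-- When the edges are added to `S` from the least to the greatest, the number of components
-- drops exactly at the cut-active edges outside `S`.
lemma numComponents_union_add_card (ref : RefOrientation G) (S U : SpanningSubgraph G)
    (hU : IsLowerSet (U : Set E(G))) :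
    numComponents (S ∪ U) + (U ∩ (cutActive S \ S)).card = numComponents S := by
  induction U using Finset.induction_on_max with
  | empty => simp
  | insert e U heU ih =>
    have mem_U (f) : f ∈ U ↔ f < e := ⟨heU f, fun hfe =>
      (Finset.mem_insert.1 (hU hfe.le (Finset.mem_insert_self e U))).resolve_left hfe.ne⟩
    have he_notMem : e ∉ U := fun h => lt_irrefl e (heU e h)
    have hU_lower : IsLowerSet (U : Set E(G)) := fun a b hba ha =>
      (mem_U b).2 (hba.trans_lt ((mem_U a).1 ha))
    rw [← ih hU_lower, Finset.union_insert]
    by_cases heS : e ∈ S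
    · rw [Finset.insert_eq_of_mem (Finset.mem_union_left _ heS),
        Finset.insert_inter_of_notMem fun h => (Finset.mem_sdiff.1 h).2 heS]
    · have h_iff := mem_cutActive_iff_not_joined (ref := ref) (d := (e, true)) heS mem_U
      by_cases he : e ∈ cutActive S
      · rw [← numComponents_insert_of_not_joined (h_iff.1 he),
          Finset.insert_inter_of_mem (Finset.mem_sdiff.2 ⟨he, heS⟩),
          Finset.card_insert_of_notMem fun h => he_notMem (Finset.mem_inter.1 h).1]
        ring
      · rw [numComponents_insert_of_joined (not_not.1 fun h => he (h_iff.2 h)),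
          Finset.insert_inter_of_notMem fun h => he (Finset.mem_sdiff.1 h).1]

-- When `S` is built up from the greatest edge to the least, its cycle-active edges are the ones
-- that do not reduce the number of components.
lemma card_inter_add_numComponents_inter (ref : RefOrientation G) (S U : SpanningSubgraph G)
    (hU : IsUpperSet (U : Set E(G))) :
    (S ∩ U).card + numComponents (S ∩ U) =
      Nat.card V(G) + (U ∩ (cycleActive S ∩ S)).card := by
  induction U using Finset.induction_on_min with
  | empty => simp [numComponents_empty]
  | insert e U heU ih =>
    have mem_U (f) : f ∈ U ↔ e < f := ⟨heU f, fun hef =>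
      (Finset.mem_insert.1 (hU hef.le (Finset.mem_insert_self e U))).resolve_left hef.ne'⟩
    have he_notMem : e ∉ U := fun h => lt_irrefl e (heU e h)
    have ih := ih fun a b hab ha => (mem_U b).2 (((mem_U a).1 ha).trans_le hab)
    by_cases heS : e ∈ S
    · have h_iff := mem_cycleActive_iff_joined (ref := ref) (d := (e, true)) heS mem_U
      rw [Finset.inter_insert_of_mem heS,
        Finset.card_insert_of_notMem fun h => he_notMem (Finset.mem_inter.1 h).2]
      by_cases he : e ∈ cycleActive S
      · rw [numComponents_insert_of_joined (h_iff.1 he),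
          Finset.insert_inter_of_mem (Finset.mem_inter.2 ⟨he, heS⟩),
          Finset.card_insert_of_notMem fun h => he_notMem (Finset.mem_inter.1 h).1]
        lia
      · have h_card := numComponents_insert_of_not_joined fun h => he (h_iff.2 h)
        rw [Finset.insert_inter_of_notMem fun h => he (Finset.mem_inter.1 h).1, ← ih, ← h_card]
        ring
    · rw [Finset.inter_insert_of_notMem heS,
        Finset.insert_inter_of_notMem fun h => heS (Finset.mem_inter.1 h).2, ih]

lemma card_cutActive_sdiff (ref : RefOrientation G) (S : SpanningSubgraph G) :
    (cutActive S \ S).card =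
      numComponents S - numComponents (Finset.univ : SpanningSubgraph G) := by
  have h := numComponents_union_add_card ref S Finset.univ (by simpa using isLowerSet_univ)
  rw [Finset.union_eq_right.2 (Finset.subset_univ S), Finset.univ_inter] at h
  lia

lemma card_cycleActive_inter (ref : RefOrientation G) (S : SpanningSubgraph G) :
    (cycleActive S ∩ S).card = S.card + numComponents S - Nat.card V(G) := by
  have h := card_inter_add_numComponents_inter ref S Finset.univ (by simpa using isUpperSet_univ)
  rw [Finset.inter_univ, Finset.univ_inter] at h
  lia

end Counting

section Expansion

lemma prod_add_mul_prod_compl_add {E R : Type*} [Fintype E] [DecidableEq E] [CommSemiring R]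
    (k₁ k₂ l m : E → R) (S : Finset E) :
    (∏ e ∈ S, (k₁ e + m e)) * ∏ e ∈ Sᶜ, (k₂ e + l e) =
      ∑ T : Finset E, (∏ e ∈ T ∩ S, k₁ e) * (∏ e ∈ T \ S, k₂ e) *
        (∏ e ∈ Tᶜ \ S, l e) * ∏ e ∈ Tᶜ ∩ S, m e := by
  have prod_ite_mem (T : Finset E) (f g : E → R) :
      ∏ e ∈ T, (if e ∈ S then f e else g e) = (∏ e ∈ T ∩ S, f e) * ∏ e ∈ T \ S, g e := by
    rw [Finset.prod_ite, Finset.filter_mem_eq_inter, Finset.filter_notMem_eq_sdiff]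
  calc (∏ e ∈ S, (k₁ e + m e)) * ∏ e ∈ Sᶜ, (k₂ e + l e)
      = ∏ e, if e ∈ S then k₁ e + m e else k₂ e + l e := by
        rw [prod_ite_mem, Finset.univ_inter, Finset.compl_eq_univ_sdiff]
    _ = ∏ e, ((if e ∈ S then k₁ e else k₂ e) + if e ∈ S then m e else l e) :=
        Finset.prod_congr rfl fun e _ => by split_ifs <;> rfl
    _ = _ := by
        rw [Fintype.prod_add]
        refine Finset.sum_congr rfl fun T _ => ?_
        rw [prod_ite_mem, prod_ite_mem]
        ring

variable {α β : Type*} {G : Graph α β} [Fintype E(G)] [LinearOrder E(G)]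
  {ref : RefOrientation G} {σu σb : E(G) → Bool} {φ : Four G → SpanningSubgraph G}

lemma IsActivityMap.notMem_of_mem_unorientedEdges (h : IsActivityMap ref σu σb φ) {O : Four G}
    {e : E(G)} (he : e ∈ unorientedEdges O) : e ∉ φ O :=
  Finset.disjoint_left.1 (h.unoriented_disjoint O) he

lemma IsActivityMap.unorientedEdges_eq (h : IsActivityMap ref σu σb φ) (O : Four G) :
    unorientedEdges O = (orientedEdges O)ᶜ \ φ O := by
  ext e
  have h_unoriented : e ∈ unorientedEdges O → e ∉ φ O := h.notMem_of_mem_unorientedEdges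
  have h_bioriented : e ∈ biorientedEdges O → e ∈ φ O := fun he => h.bioriented_subset O he
  simp only [Finset.mem_sdiff, Finset.mem_compl, mem_orientedEdges, mem_unorientedEdges,
    mem_biorientedEdges] at *
  tauto

lemma IsActivityMap.biorientedEdges_eq (h : IsActivityMap ref σu σb φ) (O : Four G) :
    biorientedEdges O = (orientedEdges O)ᶜ ∩ φ O := by
  ext e
  have h_unoriented : e ∈ unorientedEdges O → e ∉ φ O := h.notMem_of_mem_unorientedEdges
  have h_bioriented : e ∈ biorientedEdges O → e ∈ φ O := fun he => h.bioriented_subset O he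
  simp only [Finset.mem_inter, Finset.mem_compl, mem_orientedEdges, mem_unorientedEdges,
    mem_biorientedEdges] at *
  tauto

lemma IsActivityMap.fourCutActive_inter_union (h : IsActivityMap ref σu σb φ) (O : Four G) :
    fourCutActive φ O ∩ unorientedEdges O ∪ fourCutActive φ O ∩ negEdges O =
      cutActive (φ O) \ φ O := by
  ext e
  have h_unoriented : e ∈ unorientedEdges O → e ∉ φ O := h.notMem_of_mem_unorientedEdges
  have h_bioriented : e ∈ biorientedEdges O → e ∈ φ O := fun he => h.bioriented_subset O he
  have h_pos : e ∈ fourCutActive φ O ∩ posEdges O → e ∈ φ O := fun he => h.cut_pos_subset O he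
  have h_neg : e ∈ fourCutActive φ O ∩ negEdges O → e ∉ φ O :=
    fun he => Finset.disjoint_left.1 (h.cut_neg_disjoint O) he
  simp only [Finset.mem_union, Finset.mem_inter, Finset.mem_sdiff, fourCutActive,
    mem_unorientedEdges, mem_biorientedEdges, mem_posEdges, mem_negEdges] at *
  tauto

lemma IsActivityMap.fourCycleActive_inter_union (h : IsActivityMap ref σu σb φ) (O : Four G) :
    fourCycleActive φ O ∩ biorientedEdges O ∪ fourCycleActive φ O ∩ negEdges O =
      cycleActive (φ O) ∩ φ O := by
  ext e
  have h_unoriented : e ∈ unorientedEdges O → e ∉ φ O := h.notMem_of_mem_unorientedEdges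
  have h_bioriented : e ∈ biorientedEdges O → e ∈ φ O := fun he => h.bioriented_subset O he
  have h_neg : e ∈ fourCycleActive φ O ∩ negEdges O → e ∈ φ O :=
    fun he => h.cycle_neg_subset O he
  have h_pos : e ∈ fourCycleActive φ O ∩ posEdges O → e ∉ φ O :=
    fun he => Finset.disjoint_left.1 (h.cycle_pos_disjoint O) he
  simp only [Finset.mem_union, Finset.mem_inter, fourCycleActive,
    mem_unorientedEdges, mem_biorientedEdges, mem_posEdges, mem_negEdges] at *
  tauto

lemma IsActivityMap.normalFunction_eq [Finite V(G)] (h : IsActivityMap ref σu σb φ) {R : Type*}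
    [CommRing R] (k₁ k₂ l m : E(G) → R) (w z : R) :
    normalFunction (fun e => k₁ e + m e) (fun e => k₂ e + l e) (1 + w) (1 + z) =
      fourientationSum φ k₁ k₂ l m w z := by
  have sum_over_pairs : fourientationSum φ k₁ k₂ l m w z =
      ∑ p : SpanningSubgraph G × SpanningSubgraph G,
        (∏ e ∈ p.2 ∩ p.1, k₁ e) * (∏ e ∈ p.2 \ p.1, k₂ e) * (∏ e ∈ p.2ᶜ \ p.1, l e) *
          (∏ e ∈ p.2ᶜ ∩ p.1, m e) * w ^ (cutActive p.1 \ p.1).card *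
          z ^ (cycleActive p.1 ∩ p.1).card := by
    rw [← h.bijective.sum_comp, fourientationSum]
    refine Finset.sum_congr rfl fun O _ => ?_
    rw [h.fourCutActive_inter_union, h.fourCycleActive_inter_union, h.unorientedEdges_eq,
      h.biorientedEdges_eq]
  rw [sum_over_pairs, Fintype.sum_prod_type, normalFunction]
  refine Finset.sum_congr rfl fun S _ => ?_
  rw [← card_cutActive_sdiff ref, ← card_cycleActive_inter ref, prod_add_mul_prod_compl_add,
    add_sub_cancel_left, add_sub_cancel_left, Finset.sum_mul, Finset.sum_mul]

end Expansion

end Fourientation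

/-- For every finite multigraph with a reference orientation, a total order of its edges and sign
labels there are maps `φ` from fourientations to spanning subgraphs with the required properties,
and the edge-weighted expansion of the normal function holds for each of them. -/
theorem mainTheorem3 {α β : Type*} (G : Graph α β) [Finite V(G)] [Fintype E(G)]
    [LinearOrder E(G)] (ref : Fourientation.RefOrientation G) (σu σb : E(G) → Bool) :
    (∃ φ : Fourientation.Four G → Fourientation.SpanningSubgraph G,
      Fourientation.IsActivityMap ref σu σb φ) ∧
    ∀ φ : Fourientation.Four G → Fourientation.SpanningSubgraph G,
      Fourientation.IsActivityMap ref σu σb φ →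
      ∀ {R : Type*} [CommRing R] (k₁ k₂ l m : E(G) → R) (w z : R),
        Fourientation.normalFunction (fun e => k₁ e + m e) (fun e => k₂ e + l e) (1 + w) (1 + z) =
          Fourientation.fourientationSum φ k₁ k₂ l m w z :=
  ⟨Fourientation.exists_isActivityMap ref σu σb,
    fun _ hφ _ _ k₁ k₂ l m w z => hφ.normalFunction_eq k₁ k₂ l m w z⟩
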